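/- **Notation.** Let $d\ge 0$ be an integer and let $\mathcal E,\mathcal E_*$ be complex Hilbert spaces. Write $e_1,\dots,e_d$ for the standard basis of $\mathbb Z^d$. *Formal kernels.* A positive formal kernel with values in $\mathcal L(\mathcal V)$ is a series $K(z,w)=\sum_{n,m\in\mathbb Z^d}[K]_{n,m}z^nw^{-m}$ with $[K]_{n,m}\in\mathcal L(\mathcal V)$ and $\sum_{n,m}\langle [K]_{n,m}v_m,v_n\rangle\ge 0$ for all finitely supported $(v_n)$ in the Hilbert space $\mathcal V$. $\mathcal H(K)$ denotes its (formal) reproducing kernel Hilbert space, which consists of formal Laurent series with coefficients in $\mathcal V$. For a family $(K_j)_{j\in J}$ of positive formal kernels, the overlapping space $\mathcal L(\{K_j\}_{j\in J})$ is the set of all $\bigoplus_j f_j$ in the Hilbert space direct sum $\bigoplus_{j}\mathcal H(K_j)$ for which $\sum_j f_j(z)=0$ (coefficientwise, weakly). *Augmented Agler decompositions.* Let $S(z)=\sum_{n\in\mathbb Z^d_+}S_nz^n$ be a formal power series with coefficients in $\mathcal L(\mathcal E,\mathcal E_*)$. Positive formal kernels $K_1,\dots,K_d$ with values in $\mathcal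 L(\mathcal E_*\oplus\mathcal E)$ form an augmented Agler decomposition of $S$ if, in each $K_k$, the first row is supported on powers $z^n$ with $n\in\mathbb Z^d_+$, the second row is supported on powers $z^n$ with $-n-e_k\in\mathbb Z^d_+$, and $$\sum_{k=1}^d(1-z_kw_k^{-1})K_k(z,w)=\begin{bmatrix} I-S(z)S(w)^* & S(w)-S(z)\\ S(z)^*-S(w)^* & S(z)^*S(w)-I\end{bmatrix},$$ where $(z^n)^*=z^{-n}$ and $(w^n)^*=w^{-n}$. (A series $S$ with such a decomposition belongs to the Schur–Agler class.) The decomposition is *strictly closely connected* if $\mathcal L(K_1,\dots,K_d)=\{0\}$ and $\mathcal L(K_1',\dots,K_d')=\{0\}$, where $K'_k(z,w)=z_kK_k(z,w)w_k^{-1}$. A set $\Omega\subset\mathbb Z^d$ is *shift-invariant* if $n\in\Omega$ implies $n+e_k\in\Omega$ for all $k$. It has *no boundary at infinity* if no line $n+\mathbb Ze_k$ is contained in $\Omega$ and none is disjoint from $\Omega$. Put $\partial_k\Omega=\{n\in\mathbb Z^d: n_k=\min\{t:(n_1,\dots,n_{k-1},t,n_{k+1},\dots,n_d)\in\Omega\}\}$.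 The balanced set $\{n:n_1+\dots+n_d\ge0\}$ is an example. The decomposition is *minimal* if it is strictly closely connected and, for some shift-invariant $\Omega$ without boundary at infinity, the overlapping space of the family of kernels $z^nK_k(z,w)w^{-n}$, indexed by $1\le k\le d$ and $n\in\partial_k\Omega$, is $\{0\}$. *Colligations.* A GR-unitary (Givone–Roesser unitary) colligation consists of a Hilbert space $\mathcal H$, a unitary operator $$U=\begin{bmatrix}A&B\\C&D\end{bmatrix}:\mathcal H\oplus\mathcal E\to\mathcal H\oplus\mathcal E_*,$$ and orthogonal projections $P_1,\dots,P_d$ on $\mathcal H$ with pairwise orthogonal ranges and $P_1+\dots+P_d=I$. Put $Z(z)=z_1P_1+\dots+z_dP_d$, $Z(z)^{-1}=z_1^{-1}P_1+\dots+z_d^{-1}P_d$ and $$\Pi(z)=\begin{bmatrix}C(I-Z(z)A)^{-1}\\ B^*(I-Z(z)^{-1}A^*)^{-1}Z(z)^{-1}\end{bmatrix},$$ with the inverses expanded as formal geometric series. - It *realizes* $S$ if $S(z)=D+C(I-Z(z)A)^{-1}Z(z)B$. - It is *compatible* with $K_1,\dots,K_d$ if $K_k(z,w)=\Pi(z)P_k\Pi(w)^*$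 for all $k$. - It is *closely connected* if the smallest closed subspace of $\mathcal H$ that contains $\operatorname{im}B$ and $\operatorname{im}C^*$ and is invariant under $A,A^*,P_1,\dots,P_d$ is $\mathcal H$. - It is *strictly closely connected* if $h\mapsto\Pi(z)h$ is injective on $\mathcal H$. - It is *scattering-minimal* if, for every shift-invariant $\Omega$ without boundary at infinity, the map $(x_k)_k\mapsto\Pi(z)\sum_{k}\sum_{n\in\partial_k\Omega}x_k(n)z^n$ is injective on $\bigoplus_{k}\ell^2(\partial_k\Omega,\operatorname{im}P_k)$. - Two colligations are *unitarily equivalent* if there is a unitary map $W$ between their state spaces with $WP_k=P_k'W$ for all $k$ and $(W\oplus I_{\mathcal E_*})U=U'(W\oplus I_{\mathcal E})$. **Corollary.** Let $K_1,\dots,K_d$ be a strictly closely connected augmented Agler decomposition of $S$. Then there is a closely connected GR-unitary colligation that realizes $S$ and is compatible with $K_1,\dots,K_d$, and any two such colligations are unitarily equivalent. Every such colligation is strictly closely connected, and, if the decomposition is minimal, it is scattering-minimal. -/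

import Mathlib

open scoped InnerProductSpace ENNReal ComplexOrder

universe u v w w'

noncomputable section

/-- The multi-index `e_k ∈ ℤ^d`. -/
abbrev unitIdx {d : ℕ} (k : Fin d) : Fin d → ℤ := Pi.single k 1

section Kernels

variable {d : ℕ} {V : Type u} [NormedAddCommGroup V] [InnerProductSpace ℂ V] [CompleteSpace V]

/-- A positive formal kernel `K(z,w) = ∑_{n,m ∈ ℤ^d} [K]_{n,m} z^n w^{-m}` with coefficients
`[K]_{n,m} = coeff n m` bounded operators on the Hilbert space `V`. -/
structure PosKernel (d : ℕ) (V : Type u) [NormedAddCommGroup V] [InnerProductSpace ℂ V]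
    [CompleteSpace V] where
  coeff : Matrix (Fin d → ℤ) (Fin d → ℤ) (V →L[ℂ] V)
  pos : coeff.PosSemidef

instance PosKernel.instFact (K : PosKernel d V) : Fact K.coeff.PosSemidef := ⟨K.pos⟩

/-- The kernel `z^s K(z,w) w^{-s}`; its reproducing kernel space is `z^s H(K)`. -/
def PosKernel.shift (K : PosKernel d V) (s : Fin d → ℤ) : PosKernel d V where
  coeff := K.coeff.submatrix (fun n => n - s) (fun n => n - s)
  pos := K.pos.submatrix _

/-- The formal reproducing kernel Hilbert space `H(K)`. Its elements are formal Laurent series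
`f(z) = ∑_n (f n) z^n` with coefficients `f n` in `V`. -/
abbrev PosKernel.space (K : PosKernel d V) : Type u := RKHS.OfKernel K.coeff

/-- The overlapping space of a family of positive formal kernels: the kernel of the sum map
`⊕_j f_j ↦ ∑_j f_j(z)` on the Hilbert space direct sum of the spaces `H(K_j)`, where the sum is
taken coefficientwise and weakly. -/
def overlappingSpace {ι : Type} (K : ι → PosKernel d V) :
    Submodule ℂ (lp (fun j => (K j).space) 2) where
  carrier := {f | ∀ (n : Fin d → ℤ) (v : V), HasSum (fun j => ⟪v, (f j) n⟫_ℂ) 0}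
  zero_mem' := by
    intro n v
    simp
  add_mem' := by
    intro f g hf hg n v
    simpa [inner_add_right] using (hf n v).add (hg n v)
  smul_mem' := by
    intro c f hf n v
    simpa [inner_smul_right] using (hf n v).mul_left c

end Kernels

section Sublattices

variable {d : ℕ}

/-- A subset of `ℤ^d` is shift-invariant if it is invariant under all the shifts
`n ↦ n + e_k`. -/
def IsShiftInvariant (Ω : Set (Fin d → ℤ)) : Prop :=
  ∀ n ∈ Ω, ∀ k, n + unitIdx k ∈ Ω

/-- The finite `k`-boundary of `Ω`: the points `n` such that `n_k` is the smallest `t` for which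
`(n_1, …, n_{k-1}, t, n_{k+1}, …, n_d)` lies in `Ω`. -/
def finBoundary (Ω : Set (Fin d → ℤ)) (k : Fin d) : Set (Fin d → ℤ) :=
  {n | IsLeast {t : ℤ | Function.update n k t ∈ Ω} (n k)}

/-- `Ω` has no boundary at infinity: no line parallel to a coordinate axis is disjoint from `Ω`,
and no such line is contained in `Ω`. -/
def HasNoInfiniteBoundary (Ω : Set (Fin d → ℤ)) : Prop :=
  ∀ (n : Fin d → ℤ) (k : Fin d),
    (∃ t : ℤ, Function.update n k t ∈ Ω) ∧ ∃ t : ℤ, Function.update n k t ∉ Ω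

/-- Pairs consisting of an index `k` and a point of the finite `k`-boundary of `Ω`. -/
abbrev BoundaryIndex (Ω : Set (Fin d → ℤ)) : Type := Σ k : Fin d, finBoundary Ω k

end Sublattices

section Decompositions

variable {d : ℕ} {E : Type u} {Es : Type v}
  [NormedAddCommGroup E] [InnerProductSpace ℂ E] [CompleteSpace E]
  [NormedAddCommGroup Es] [InnerProductSpace ℂ Es] [CompleteSpace Es]

/-- The kernels `K_1, …, K_d` form an augmented Agler decomposition of the formal power series
`S(z) = ∑_n S_n z^n`. The first row of `K_k` is supported on nonnegative powers of `z`, and the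
second row is `z_k^{-1}` times a series in nonpositive powers of `z`. The identity is
`∑_k (1 - z_k w_k^{-1}) K_k(z,w) =
  [ I - S(z) S(w)^*, S(w) - S(z) ; S(z)^* - S(w)^*, S(z)^* S(w) - I ]`,
where `S(w)^* = ∑_n S_n^* w^{-n}`, written out for the coefficient of `z^n w^{-m}`. -/
structure IsAugmentedAglerDecomposition (S : (Fin d → ℤ) → (E →L[ℂ] Es))
    (K : Fin d → PosKernel d (WithLp 2 (Es × E))) : Prop where
  series_support : ∀ n, ¬ 0 ≤ n → S n = 0
  fst_support : ∀ k n m x, ¬ 0 ≤ n → ((K k).coeff n m x).fst = 0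
  snd_support : ∀ k n m x, ¬ 0 ≤ -n - unitIdx k → ((K k).coeff n m x).snd = 0
  fst_eq : ∀ n m (x : WithLp 2 (Es × E)),
    (∑ k, ((K k).coeff n m - ((K k).shift (unitIdx k)).coeff n m) x).fst =
      ((if n = 0 ∧ m = 0 then x.fst else 0) - S n (ContinuousLinearMap.adjoint (S m) x.fst)) +
      ((if n = 0 then S (-m) x.snd else 0) - (if m = 0 then S n x.snd else 0))
  snd_eq : ∀ n m (x : WithLp 2 (Es × E)),
    (∑ k, ((K k).coeff n m - ((K k).shift (unitIdx k)).coeff n m) x).snd =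
      ((if m = 0 then ContinuousLinearMap.adjoint (S (-n)) x.fst else 0) -
        (if n = 0 then ContinuousLinearMap.adjoint (S m) x.fst else 0)) +
      (ContinuousLinearMap.adjoint (S (-n)) (S (-m) x.snd) -
        (if n = 0 ∧ m = 0 then x.snd else 0))

/-- Both overlapping spaces `L(K_1, …, K_d)` and `L(K'_1, …, K'_d)` are trivial, where
`K'_k(z,w) = z_k K_k(z,w) w_k^{-1}`. -/
def IsStrictlyCloselyConnectedDecomposition {V : Type u} [NormedAddCommGroup V]
    [InnerProductSpace ℂ V] [CompleteSpace V] (K : Fin d → PosKernel d V) : Prop :=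
  overlappingSpace K = ⊥ ∧ overlappingSpace (fun k => (K k).shift (unitIdx k)) = ⊥

/-- Minimality with respect to `Ω` (a set without boundary at infinity): the decomposition is
strictly closely connected, and the spaces `z^n H(K_k)`, with `n` in the finite `k`-boundary of
`Ω`, have no overlap. -/
def IsMinimalDecomposition {V : Type u} [NormedAddCommGroup V]
    [InnerProductSpace ℂ V] [CompleteSpace V] (Ω : Set (Fin d → ℤ))
    (K : Fin d → PosKernel d V) : Prop :=
  IsStrictlyCloselyConnectedDecomposition K ∧
    overlappingSpace (fun j : BoundaryIndex Ω => (K j.1).shift j.2) = ⊥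

end Decompositions

section Series

variable {d : ℕ} {H : Type w} [NormedAddCommGroup H] [InnerProductSpace ℂ H]

/-- The coefficient of `z^n` in `(z_1 T_1 + ⋯ + z_d T_d)^N`. -/
def pencilPowCoeff (T : Fin d → (H →L[ℂ] H)) : ℕ → (Fin d → ℤ) → (H →L[ℂ] H)
  | 0, n => if n = 0 then 1 else 0
  | N + 1, n => ∑ k, T k * pencilPowCoeff T N (n - unitIdx k)

/-- The coefficient of `z^n` in `(I - (z_1 T_1 + ⋯ + z_d T_d))⁻¹ = ∑_N (∑_k z_k T_k)^N`.
Only `N = n_1 + ⋯ + n_d` contributes. -/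
def resolventCoeff (T : Fin d → (H →L[ℂ] H)) (n : Fin d → ℤ) : H →L[ℂ] H :=
  pencilPowCoeff T (∑ k, n k).toNat n

end Series

/-- A Givone–Roesser unitary colligation in coordinate-free form: a unitary operator
`U : H ⊕ E → H ⊕ E_*` with orthogonal projections `P_1, …, P_d` on `H` that have pairwise
orthogonal ranges and sum up to the identity. -/
structure GRColligation (d : ℕ) (H : Type w) (E : Type u) (Es : Type v)
    [NormedAddCommGroup H] [InnerProductSpace ℂ H] [CompleteSpace H]
    [NormedAddCommGroup E] [InnerProductSpace ℂ E] [CompleteSpace E]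
    [NormedAddCommGroup Es] [InnerProductSpace ℂ Es] [CompleteSpace Es] where
  U : WithLp 2 (H × E) ≃ₗᵢ[ℂ] WithLp 2 (H × Es)
  P : Fin d → (H →L[ℂ] H)
  isStarProjection : ∀ k, IsStarProjection (P k)
  orthogonal : ∀ j k, j ≠ k → P j * P k = 0
  sum_eq_one : ∑ k, P k = 1

namespace GRColligation

variable {d : ℕ} {H : Type w} {E : Type u} {Es : Type v}
  [NormedAddCommGroup H] [InnerProductSpace ℂ H] [CompleteSpace H]
  [NormedAddCommGroup E] [InnerProductSpace ℂ E] [CompleteSpace E]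
  [NormedAddCommGroup Es] [InnerProductSpace ℂ Es] [CompleteSpace Es]

/-- The restriction of `U` to the state space. -/
def onState (G : GRColligation d H E Es) : H →L[ℂ] WithLp 2 (H × Es) :=
  (G.U.toContinuousLinearEquiv : WithLp 2 (H × E) →L[ℂ] WithLp 2 (H × Es)) ∘L
    ((WithLp.prodContinuousLinearEquiv 2 ℂ H E).symm : H × E →L[ℂ] WithLp 2 (H × E)) ∘L
      ContinuousLinearMap.inl ℂ H E

/-- The restriction of `U` to the input space. -/
def onInput (G : GRColligation d H E Es) : E →L[ℂ] WithLp 2 (H × Es) :=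
  (G.U.toContinuousLinearEquiv : WithLp 2 (H × E) →L[ℂ] WithLp 2 (H × Es)) ∘L
    ((WithLp.prodContinuousLinearEquiv 2 ℂ H E).symm : H × E →L[ℂ] WithLp 2 (H × E)) ∘L
      ContinuousLinearMap.inr ℂ H E

/-- The block `A` of `U = [A B; C D]`. -/
def A (G : GRColligation d H E Es) : H →L[ℂ] H := WithLp.fstL 2 ℂ H Es ∘L G.onState

/-- The block `B` of `U = [A B; C D]`. -/
def B (G : GRColligation d H E Es) : E →L[ℂ] H := WithLp.fstL 2 ℂ H Es ∘L G.onInput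

/-- The block `C` of `U = [A B; C D]`. -/
def C (G : GRColligation d H E Es) : H →L[ℂ] Es := WithLp.sndL 2 ℂ H Es ∘L G.onState

/-- The block `D` of `U = [A B; C D]`. -/
def D (G : GRColligation d H E Es) : E →L[ℂ] Es := WithLp.sndL 2 ℂ H Es ∘L G.onInput

/-- The coefficient of `z^n` in `(I - Z(z) A)⁻¹`, where `Z(z) = z_1 P_1 + ⋯ + z_d P_d`. -/
def fwd (G : GRColligation d H E Es) (n : Fin d → ℤ) : H →L[ℂ] H :=
  resolventCoeff (fun k => G.P k ∘L G.A) n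

/-- The coefficient of `z^{-n}` in `(I - Z(z)⁻¹ A^*)⁻¹`, where
`Z(z)⁻¹ = z_1^{-1} P_1 + ⋯ + z_d^{-1} P_d`. -/
def bwd (G : GRColligation d H E Es) (n : Fin d → ℤ) : H →L[ℂ] H :=
  resolventCoeff (fun k => G.P k ∘L ContinuousLinearMap.adjoint G.A) n

/-- The coefficient of `z^n` in the transfer function `D + C (I - Z(z) A)⁻¹ Z(z) B`. -/
def transferCoeff (G : GRColligation d H E Es) (n : Fin d → ℤ) : E →L[ℂ] Es :=
  (if n = 0 then G.D else 0) + ∑ k, G.C ∘L G.fwd (n - unitIdx k) ∘L G.P k ∘L G.B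

/-- The colligation realizes the formal power series `S(z) = ∑_n S_n z^n`. -/
def Realizes (G : GRColligation d H E Es) (S : (Fin d → ℤ) → (E →L[ℂ] Es)) : Prop :=
  ∀ n, G.transferCoeff n = S n

/-- The coefficient of `z^n` in the formal series with operator coefficients
`Π(z) = [ C (I - Z(z) A)⁻¹ ; B^* (I - Z(z)⁻¹ A^*)⁻¹ Z(z)⁻¹ ]`. -/
def obs (G : GRColligation d H E Es) (n : Fin d → ℤ) : H →L[ℂ] WithLp 2 (Es × E) :=
  ((WithLp.prodContinuousLinearEquiv 2 ℂ Es E).symm : Es × E →L[ℂ] WithLp 2 (Es × E)) ∘L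
    (G.C ∘L G.fwd n).prod
      (∑ k, ContinuousLinearMap.adjoint G.B ∘L G.bwd (-n - unitIdx k) ∘L G.P k)

/-- The colligation is compatible with the kernels `K_1, …, K_d`, i.e.
`K_k(z,w) = Π(z) P_k Π(w)^*` for all `k`. -/
def Compatible (G : GRColligation d H E Es)
    (K : Fin d → PosKernel d (WithLp 2 (Es × E))) : Prop :=
  ∀ k n m, (K k).coeff n m = G.obs n ∘L G.P k ∘L ContinuousLinearMap.adjoint (G.obs m)

/-- The only closed subspace of `H` that contains the ranges of `B` and `C^*` and is invariant
under `A`, `A^*` and `P_1, …, P_d` is `H`. -/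
def CloselyConnected (G : GRColligation d H E Es) : Prop :=
  ∀ M : Submodule ℂ H, IsClosed (M : Set H) →
    (∀ e, G.B e ∈ M) → (∀ y, ContinuousLinearMap.adjoint G.C y ∈ M) →
    (∀ h ∈ M, G.A h ∈ M) → (∀ h ∈ M, ContinuousLinearMap.adjoint G.A h ∈ M) →
    (∀ k, ∀ h ∈ M, G.P k h ∈ M) → M = ⊤

/-- The map `h ↦ Π(z) h` is injective. -/
def StrictlyCloselyConnected (G : GRColligation d H E Es) : Prop :=
  Function.Injective fun (h : H) (n : Fin d → ℤ) => G.obs n h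

/-- The map that sends boundary data `x_k : ∂_kΩ → im P_k`, `k = 1, …, d`, of finite energy
`∑_k ∑_{n ∈ ∂_kΩ} ‖x_k(n)‖²` to the output and input series
`Π(z) ∑_k ∑_{n ∈ ∂_kΩ} x_k(n) z^n` is injective. For `Ω` without boundary at infinity each
coefficient of this series is a finite sum. -/
def ScatteringMinimalOn (Ω : Set (Fin d → ℤ)) (G : GRColligation d H E Es) : Prop :=
  ∀ x : lp (fun _ : BoundaryIndex Ω => H) 2, (∀ j, G.P j.1 (x j) = x j) →
    (∀ p : Fin d → ℤ, HasSum (fun j : BoundaryIndex Ω => G.obs (p - j.2) (x j)) 0) → x = 0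

/-- Scattering-minimality: the map from boundary data on `Ω` to output and input series is
injective, for every shift-invariant `Ω` without boundary at infinity. -/
def ScatteringMinimal (G : GRColligation d H E Es) : Prop :=
  ∀ Ω : Set (Fin d → ℤ), IsShiftInvariant Ω → HasNoInfiniteBoundary Ω → G.ScatteringMinimalOn Ω

/-- Unitary equivalence of colligations with the same input and output spaces: a unitary map of
the state spaces that intertwines the projections and the colligation operators. -/
def UnitarilyEquivalent {H' : Type*} [NormedAddCommGroup H'] [InnerProductSpace ℂ H']
    [CompleteSpace H'] (G : GRColligation d H E Es) (G' : GRColligation d H' E Es) : Prop :=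
  ∃ W : H ≃ₗᵢ[ℂ] H', (∀ k h, W (G.P k h) = G'.P k (W h)) ∧
    ∀ (h : H) (e : E), G'.U (WithLp.toLp 2 (W h, e)) =
      WithLp.toLp 2 (W (G.U (WithLp.toLp 2 (h, e))).fst, (G.U (WithLp.toLp 2 (h, e))).snd)

end GRColligation

end

/-!
The Agler decomposition is rewritten as
`∑_k K_k(z,w) + [S(z); I] [S(w); I]^* = ∑_k z_k K_k(z,w) w_k^{-1} + [I; S(z)^*] [I; S(w)^*]^*`.
For any factorization `K_k(z,w) = Φ(z) P_k Φ(w)^*` through a Hilbert space `H`, this says that the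
adjoints of the two series of operators
`(h, e) ↦ Φ(z) h + [S(z); I] e` on `H ⊕ E` (`inputSide`) and
`(h, y) ↦ ∑_k z_k Φ(z) P_k h + [I; S(z)^*] y` on `H ⊕ E_*` (`outputSide`)
have the same Gram matrix. If `h ↦ Φ(z) h` is injective, then the support conditions and the absence
of overlap make both series injective, so they are related by a unitary operator `U`
(`exists_unitary_outputSide_eq_inputSide`).

*Existence.* The canonical state space `H(K_1) ⊕ ⋯ ⊕ H(K_d)`, with the sum map as `Φ`, is such a
factorization, and `h ↦ Φ(z) h` is injective because `L(K_1, …, K_d) = {0}`. The relation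
`outputSide ∘ U = inputSide` is a recursion for the coefficients of `Φ`, whose unique solution is
the observability series `Π` of `U` (`GRColligation.obs_eq_of_outputSide_U`). So `U` is compatible
with the kernels, and it realizes `S`.

*Uniqueness.* For a compatible colligation the kernel of `h ↦ Π(z) h` is invariant under `A`, `A^*`
and the projections, since there is no overlap. A closely connected colligation is therefore
strictly closely connected (`GRColligation.CloselyConnected.strictlyCloselyConnected`). Two such
colligations factor the same kernels, which gives the unitary map between the state spaces; it
intertwines the colligation operators because `outputSide ∘ U = inputSide` determines `U`
(`GRColligation.unitarilyEquivalent`).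

*Scattering-minimality.* Boundary data on `Ω` with vanishing series are the boundary values of a
null trajectory: a solution of the system equations on the whole lattice with zero input and output
(`GRColligation.exists_isNullTrajectory`). Along a null trajectory the energies `‖P_k x(n)‖²` form a
divergence-free flow, so its boundary values on any other set `Ω₀` are square summable too
(`summable_boundaryIndex_of_summable`). They have vanishing series as well, so if the spaces
`z^n H(K_k)` over the boundary of `Ω₀` have no overlap, they vanish, and with them the whole
trajectory (`GRColligation.scatteringMinimal_of_isMinimalDecomposition`).
-/

/-! ### Isometries determined by Gram matrices -/

section Gram

variable {ι H₁ H₂ : Type*} [NormedAddCommGroup H₁] [InnerProductSpace ℂ H₁] [CompleteSpace H₁]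
  [NormedAddCommGroup H₂] [InnerProductSpace ℂ H₂] [CompleteSpace H₂]

/-- Two families of vectors with the same Gram matrix are related by an isometry, as soon as the
first family is total. -/
theorem exists_linearIsometry_of_gram_eq (a : ι → H₁) (b : ι → H₂)
    (hgram : ∀ i j, ⟪a i, a j⟫_ℂ = ⟪b i, b j⟫_ℂ)
    (htotal : ∀ x, (∀ i, ⟪a i, x⟫_ℂ = 0) → x = 0) :
    ∃ J : H₁ →ₗᵢ[ℂ] H₂, ∀ i, J (a i) = b i := by
  have hdense : DenseRange (Finsupp.linearCombination ℂ a) := by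
    have h : Submodule.topologicalClosure (Submodule.span ℂ (Set.range a)) = ⊤ := by
      rw [Submodule.topologicalClosure_eq_top_iff, Submodule.eq_bot_iff]
      intro x hx
      exact htotal x fun i => hx (a i) (Submodule.subset_span ⟨i, rfl⟩)
    have h' := Submodule.dense_iff_topologicalClosure_eq_top.2 h
    rw [← Finsupp.range_linearCombination] at h'
    rwa [LinearMap.coe_range] at h'
  have hnorm : ∀ c : ι →₀ ℂ,
      ‖Finsupp.linearCombination ℂ b c‖ = ‖Finsupp.linearCombination ℂ a c‖ := by
    intro c
    rw [← sq_eq_sq₀ (norm_nonneg _) (norm_nonneg _), ← inner_self_eq_norm_sq (𝕜 := ℂ),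
      ← inner_self_eq_norm_sq (𝕜 := ℂ)]
    simp [Finsupp.linearCombination_apply, Finsupp.sum, sum_inner, inner_sum, inner_smul_left,
      inner_smul_right, hgram,
      -inner_self_eq_norm_sq_to_K]
  have hbound : ∀ c : ι →₀ ℂ,
      ‖Finsupp.linearCombination ℂ b c‖ ≤ 1 * ‖Finsupp.linearCombination ℂ a c‖ := by
    intro c
    rw [hnorm, one_mul]
  set J := (Finsupp.linearCombination ℂ b).extendOfNorm (Finsupp.linearCombination ℂ a) with hJ
  have hJeq : ∀ c, J (Finsupp.linearCombination ℂ a c) = Finsupp.linearCombination ℂ b c :=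
    fun c => LinearMap.extendOfNorm_eq hdense ⟨1, hbound⟩ c
  refine ⟨⟨J.toLinearMap, fun x => ?_⟩, fun i => ?_⟩
  · refine hdense.induction_on (p := fun x => ‖J x‖ = ‖x‖) x
      (isClosed_eq (by fun_prop) (by fun_prop)) fun c => ?_
    rw [hJeq, hnorm]
  · simpa using hJeq (Finsupp.single i 1)

/-- Two total families with the same Gram matrix are related by a unitary map. -/
theorem exists_linearIsometryEquiv_of_gram_eq (a : ι → H₁) (b : ι → H₂)
    (hgram : ∀ i j, ⟪a i, a j⟫_ℂ = ⟪b i, b j⟫_ℂ)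
    (ha : ∀ x, (∀ i, ⟪a i, x⟫_ℂ = 0) → x = 0) (hb : ∀ x, (∀ i, ⟪b i, x⟫_ℂ = 0) → x = 0) :
    ∃ J : H₁ ≃ₗᵢ[ℂ] H₂, ∀ i, J (a i) = b i := by
  obtain ⟨J, hJ⟩ := exists_linearIsometry_of_gram_eq a b hgram ha
  obtain ⟨J', hJ'⟩ := exists_linearIsometry_of_gram_eq b a (fun i j => (hgram i j).symm) hb
  refine ⟨LinearIsometryEquiv.ofSurjective J fun y => ⟨J' y, ?_⟩, hJ⟩
  rw [← sub_eq_zero]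
  refine hb _ fun i => ?_
  rw [inner_sub_right]
  nth_rw 1 [← hJ i]
  rw [J.inner_map_map, ← hJ' i, J'.inner_map_map, sub_self]

end Gram

/-! ### Factored kernels and overlapping spaces -/

section Factored

variable {d : ℕ} {V : Type u} [NormedAddCommGroup V] [InnerProductSpace ℂ V] [CompleteSpace V]
  {H : Type w} [NormedAddCommGroup H] [InnerProductSpace ℂ H] [CompleteSpace H]

theorem PosKernel.inner_kerFun_kerFun (K : PosKernel d V) (n m : Fin d → ℤ) (x y : V) :
    ⟪RKHS.kerFun K.space n x, RKHS.kerFun K.space m y⟫_ℂ = ⟪x, K.coeff n m y⟫_ℂ := by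
  rw [RKHS.kerFun_inner, RKHS.kerFun_apply, RKHS.OfKernel.kernel_ofKernel]

/-- If `K(z,w) = Γ(z) Γ(w)^*`, then `x ↦ Γ(z) x` is a contraction into `H(K)`: it is the adjoint of
the isometry that sends the kernel function of `v` at `m` to `Γ_m^* v`. -/
theorem PosKernel.exists_contraction (K : PosKernel d V) (Γ : (Fin d → ℤ) → H →L[ℂ] V)
    (hΓ : ∀ n m, K.coeff n m = Γ n ∘L ContinuousLinearMap.adjoint (Γ m)) :
    ∃ R : H →L[ℂ] K.space, (∀ x, ‖R x‖ ≤ ‖x‖) ∧ ∀ x n, (R x) n = Γ n x := by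
  obtain ⟨J, hJ⟩ := exists_linearIsometry_of_gram_eq (ι := (Fin d → ℤ) × V)
    (fun i => RKHS.kerFun K.space i.1 i.2) (fun i => ContinuousLinearMap.adjoint (Γ i.1) i.2)
    (fun i j => by
      rw [K.inner_kerFun_kerFun, hΓ, ContinuousLinearMap.adjoint_inner_left]
      rfl)
    (fun f hf => by
      refine RKHS.ext fun n => ext_inner_left ℂ fun v => ?_
      have := hf (n, v)
      rw [RKHS.kerFun_inner] at this
      simpa using this)
  refine ⟨ContinuousLinearMap.adjoint J.toContinuousLinearMap, fun x => ?_, fun x n => ?_⟩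
  · refine (ContinuousLinearMap.le_opNorm _ _).trans ?_
    rw [LinearIsometryEquiv.norm_map]
    exact mul_le_of_le_one_left (norm_nonneg _) J.norm_toContinuousLinearMap_le
  · refine ext_inner_left ℂ fun v => ?_
    rw [← RKHS.kerFun_inner, ContinuousLinearMap.adjoint_inner_right]
    have := hJ (n, v)
    simp only at this
    rw [LinearIsometry.coe_toContinuousLinearMap, this, ContinuousLinearMap.adjoint_inner_left]

/-- If the overlapping space of the kernels `K_j(z,w) = Γ_j(z) Γ_j(w)^*` is trivial, then a square
summable family with `∑_j Γ_j(z) x_j = 0` satisfies `Γ_j(z) x_j = 0` for all `j`. -/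
theorem apply_eq_zero_of_overlappingSpace_eq_bot {ι : Type} (K : ι → PosKernel d V)
    (hK : overlappingSpace K = ⊥) (Γ : ι → (Fin d → ℤ) → H →L[ℂ] V)
    (hΓ : ∀ j n m, (K j).coeff n m = Γ j n ∘L ContinuousLinearMap.adjoint (Γ j m))
    (x : ι → H) (hx : Memℓp x 2)
    (hsum : ∀ n v, HasSum (fun j => ⟪v, Γ j n (x j)⟫_ℂ) 0) (j : ι) (n : Fin d → ℤ) :
    Γ j n (x j) = 0 := by
  choose R hRnorm hR using fun j => (K j).exists_contraction (Γ j) (hΓ j)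
  have hmem : Memℓp (fun j => R j (x j)) 2 := by
    refine memℓp_gen ?_
    have h := hx.summable (by norm_num)
    refine h.of_nonneg_of_le (fun j => by positivity) fun j => ?_
    gcongr
    exact hRnorm j _
  have hf : (⟨fun j => R j (x j), hmem⟩ : lp (fun j => (K j).space) 2) ∈ overlappingSpace K := by
    intro n v
    simpa [hR] using hsum n v
  rw [hK, Submodule.mem_bot] at hf
  have h0 : R j (x j) = 0 := congrFun (congrArg Subtype.val hf) j
  rw [← hR, h0, RKHS.coe_zero, Pi.zero_apply]

end Factored

/-! ### Recursions on the lattice -/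

section Lattice

variable {d : ℕ}

/-- Every point of `ℤ^d` has a lower bound for those of its predecessors that lie in `Ω`, so that
recursions over `Ω` in the direction of the shifts are well-founded. -/
def HasBoundedPast (Ω : Set (Fin d → ℤ)) : Prop :=
  ∀ p, ∃ b, ∀ q ∈ Ω, q ≤ p → b ≤ q

theorem sum_sub_unitIdx (n : Fin d → ℤ) (k : Fin d) :
    ∑ i, (n - unitIdx k) i = ∑ i, n i - 1 := by
  simp [Finset.sum_sub_distrib]

theorem unitIdx_nonneg (k : Fin d) : (0 : Fin d → ℤ) ≤ unitIdx k := by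
  simp [unitIdx]

theorem sub_unitIdx_le (n : Fin d → ℤ) (k : Fin d) : n - unitIdx k ≤ n :=
  sub_le_self _ (unitIdx_nonneg k)

theorem hasBoundedPast_Ici (b : Fin d → ℤ) : HasBoundedPast (Set.Ici b) :=
  fun _ => ⟨b, fun _ hq _ => hq⟩

/-- A function supported on `Ω` vanishes if it vanishes at each point all of whose immediate
predecessors are zeros. -/
theorem eq_zero_of_predecessors {X : Type*} [Zero X] {Ω : Set (Fin d → ℤ)} (hΩ : HasBoundedPast Ω)
    {D : (Fin d → ℤ) → X} (hsupp : ∀ n ∉ Ω, D n = 0)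
    (hrec : ∀ n, (∀ k, D (n - unitIdx k) = 0) → D n = 0) (p : Fin d → ℤ) : D p = 0 := by
  obtain ⟨b, hb⟩ := hΩ p
  -- Induction on the sum of the coordinates, which each shift changes by one.
  have key : ∀ N : ℕ, ∀ q ≤ p, ∑ i, q i < ∑ i, b i + N → D q = 0 := by
    intro N
    induction N with
    | zero =>
      intro q hq hlt
      refine hsupp q fun hqΩ => ?_
      have : ∑ i, b i ≤ ∑ i, q i := Finset.sum_le_sum fun i _ => hb q hqΩ hq i
      simp at hlt
      omega
    | succ N ih =>
      intro q hq hlt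
      refine hrec q fun k => ih _ ((sub_unitIdx_le q k).trans hq) ?_
      rw [sum_sub_unitIdx]
      push_cast at hlt
      omega
  refine key (∑ i, p i - ∑ i, b i + 1).toNat p le_rfl ?_
  have := Int.self_le_toNat (∑ i, p i - ∑ i, b i + 1)
  omega

end Lattice

/-! ### Coefficients of the resolvent -/

section Resolvent

variable {d : ℕ} {H : Type w} [NormedAddCommGroup H] [InnerProductSpace ℂ H]
  (T : Fin d → (H →L[ℂ] H))

theorem pencilPowCoeff_eq_zero {N : ℕ} {n : Fin d → ℤ} (h : ¬ 0 ≤ n) :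
    pencilPowCoeff T N n = 0 := by
  induction N generalizing n with
  | zero =>
    have : n ≠ 0 := by rintro rfl; exact h le_rfl
    simp [pencilPowCoeff, this]
  | succ N ih =>
    refine Finset.sum_eq_zero fun k _ => ?_
    rw [ih fun h' => h (h'.trans (sub_unitIdx_le n k)), mul_zero]

theorem pencilPowCoeff_succ_right (N : ℕ) (n : Fin d → ℤ) :
    pencilPowCoeff T (N + 1) n = ∑ k, pencilPowCoeff T N (n - unitIdx k) * T k := by
  induction N generalizing n with
  | zero => simp [pencilPowCoeff]
  | succ N ih =>
    conv_lhs =>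
      rw [pencilPowCoeff]
      enter [2, k]
      rw [ih]
    conv_rhs => simp only [pencilPowCoeff]
    simp_rw [Finset.mul_sum, Finset.sum_mul, mul_assoc]
    rw [Finset.sum_comm]
    refine Finset.sum_congr rfl fun k _ => Finset.sum_congr rfl fun l _ => ?_
    rw [sub_right_comm]

theorem resolventCoeff_eq_zero {n : Fin d → ℤ} (h : ¬ 0 ≤ n) : resolventCoeff T n = 0 :=
  pencilPowCoeff_eq_zero T h

theorem resolventCoeff_of_sum_nonpos {n : Fin d → ℤ} (h : ∑ i, n i ≤ 0) :
    resolventCoeff T n = if n = 0 then 1 else 0 := by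
  rw [resolventCoeff, Int.toNat_of_nonpos h, pencilPowCoeff]

theorem resolventCoeff_of_sum_neg {n : Fin d → ℤ} (h : ∑ i, n i < 0) :
    resolventCoeff T n = 0 := by
  refine resolventCoeff_eq_zero T fun h' => ?_
  have := Finset.sum_nonneg fun i (_ : i ∈ Finset.univ) => h' i
  exact absurd h (not_lt.2 this)

/-- `R = I + Z R` for the resolvent `R = (I - Z)⁻¹` of the pencil `Z = ∑_k z_k T_k`. -/
theorem resolventCoeff_eq_add_left (n : Fin d → ℤ) :
    resolventCoeff T n =
      (if n = 0 then 1 else 0) + ∑ k, T k * resolventCoeff T (n - unitIdx k) := by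
  rcases le_or_gt (∑ i, n i) 0 with h | h
  · rw [resolventCoeff_of_sum_nonpos T h, Finset.sum_eq_zero, add_zero]
    intro k _
    rw [resolventCoeff_of_sum_neg T (by rw [sum_sub_unitIdx]; omega), mul_zero]
  · have hn : n ≠ 0 := by rintro rfl; simp at h
    obtain ⟨N, hN⟩ := Int.eq_ofNat_of_zero_le (show 0 ≤ ∑ i, n i - 1 by omega)
    have h1 : (∑ i, n i).toNat = N + 1 := by omega
    simp only [resolventCoeff, sum_sub_unitIdx, h1, hN, if_neg hn, zero_add, pencilPowCoeff]
    rfl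

/-- `R = I + R Z` for the resolvent `R = (I - Z)⁻¹` of the pencil `Z = ∑_k z_k T_k`. -/
theorem resolventCoeff_eq_add_right (n : Fin d → ℤ) :
    resolventCoeff T n =
      (if n = 0 then 1 else 0) + ∑ k, resolventCoeff T (n - unitIdx k) * T k := by
  rcases le_or_gt (∑ i, n i) 0 with h | h
  · rw [resolventCoeff_of_sum_nonpos T h, Finset.sum_eq_zero, add_zero]
    intro k _
    rw [resolventCoeff_of_sum_neg T (by rw [sum_sub_unitIdx]; omega), zero_mul]
  · have hn : n ≠ 0 := by rintro rfl; simp at h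
    obtain ⟨N, hN⟩ := Int.eq_ofNat_of_zero_le (show 0 ≤ ∑ i, n i - 1 by omega)
    have h1 : (∑ i, n i).toNat = N + 1 := by omega
    simp only [resolventCoeff, sum_sub_unitIdx, h1, hN, if_neg hn, zero_add,
      pencilPowCoeff_succ_right]
    rfl

/-- The recursion `F = C + F Z`, for power series `F`, has the unique solution
`F = C (I - Z)⁻¹`. -/
theorem eq_comp_resolventCoeff {Y : Type*} [NormedAddCommGroup Y] [InnerProductSpace ℂ Y]
    (C : H →L[ℂ] Y) (F : (Fin d → ℤ) → H →L[ℂ] Y) (hsupp : ∀ n, ¬ 0 ≤ n → F n = 0)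
    (hrec : ∀ n, F n = (if n = 0 then C else 0) + ∑ k, F (n - unitIdx k) ∘L T k)
    (n : Fin d → ℤ) : F n = C ∘L resolventCoeff T n := by
  rw [← sub_eq_zero]
  refine eq_zero_of_predecessors (D := fun n => F n - C ∘L resolventCoeff T n)
    (hasBoundedPast_Ici 0) (fun n hn => ?_) (fun n hn => ?_) n
  · rw [hsupp n hn, resolventCoeff_eq_zero T hn, ContinuousLinearMap.comp_zero, sub_zero]
  · rw [hrec n, resolventCoeff_eq_add_right T n]
    simp_rw [fun k => sub_eq_zero.1 (hn k)]
    ext x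
    split_ifs <;> simp [map_sum]

/-- The identity `Z⁻¹ (I - A^* Z⁻¹)⁻¹ = (I - Z⁻¹ A^*)⁻¹ Z⁻¹`, where the left-hand side contains the
adjoint of `(I - Z A)⁻¹`. -/
theorem sum_comp_adjoint_resolventCoeff [CompleteSpace H] (P : Fin d → (H →L[ℂ] H))
    (hP : ∀ k, ContinuousLinearMap.adjoint (P k) = P k) (A : H →L[ℂ] H) (n : Fin d → ℤ) :
    ∑ k, P k ∘L
        ContinuousLinearMap.adjoint (resolventCoeff (fun k => P k ∘L A) (n - unitIdx k)) =
      ∑ k, resolventCoeff (fun k => P k ∘L ContinuousLinearMap.adjoint A) (n - unitIdx k) ∘L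
        P k := by
  have key : ∀ (N : ℕ) (n : Fin d → ℤ),
      ∑ k, P k * ContinuousLinearMap.adjoint (pencilPowCoeff (fun k => P k ∘L A) N
          (n - unitIdx k)) =
        ∑ k, pencilPowCoeff (fun k => P k ∘L ContinuousLinearMap.adjoint A) N
          (n - unitIdx k) * P k := by
    intro N
    induction N with
    | zero =>
      intro n
      refine Finset.sum_congr rfl fun k _ => ?_
      simp only [pencilPowCoeff]
      split_ifs
      · rw [← ContinuousLinearMap.star_eq_adjoint, star_one, mul_one, one_mul]
      · rw [map_zero, mul_zero, zero_mul]
    | succ N ih =>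
      intro n
      have hleft : ∀ k, ContinuousLinearMap.adjoint
          (pencilPowCoeff (fun k => P k ∘L A) (N + 1) (n - unitIdx k)) =
          ∑ j, ContinuousLinearMap.adjoint (pencilPowCoeff (fun k => P k ∘L A) N
            (n - unitIdx j - unitIdx k)) * (ContinuousLinearMap.adjoint A * P j) := by
        intro k
        rw [pencilPowCoeff, map_sum]
        refine Finset.sum_congr rfl fun j _ => ?_
        rw [ContinuousLinearMap.mul_def, ContinuousLinearMap.adjoint_comp,
          ContinuousLinearMap.adjoint_comp, hP, sub_right_comm]
        rfl
      simp_rw [hleft, Finset.mul_sum]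
      rw [Finset.sum_comm]
      refine Finset.sum_congr rfl fun j _ => ?_
      simp_rw [← mul_assoc]
      rw [← Finset.sum_mul, ← Finset.sum_mul, ih, pencilPowCoeff_succ_right]
      congr 1
      rw [Finset.sum_mul]
      rfl
  have h := key (∑ i, n i - 1).toNat n
  simp only [resolventCoeff, sum_sub_unitIdx]
  exact h

end Resolvent

section WithLp

theorem WithLp.prod_ext {α β : Type*} {x y : WithLp 2 (α × β)} (h₁ : x.fst = y.fst)
    (h₂ : x.snd = y.snd) : x = y :=
  WithLp.ofLp_injective 2 (Prod.ext h₁ h₂)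

variable {ι E Es : Type*} [NormedAddCommGroup E] [NormedSpace ℂ E] [NormedAddCommGroup Es]
  [NormedSpace ℂ Es]

theorem WithLp.sum_fst (s : Finset ι) (f : ι → WithLp 2 (Es × E)) :
    (∑ i ∈ s, f i).fst = ∑ i ∈ s, (f i).fst :=
  map_sum (WithLp.fstL 2 ℂ Es E) f s

theorem WithLp.sum_snd (s : Finset ι) (f : ι → WithLp 2 (Es × E)) :
    (∑ i ∈ s, f i).snd = ∑ i ∈ s, (f i).snd :=
  map_sum (WithLp.sndL 2 ℂ Es E) f s

end WithLp

/-! ### Factorizations of a family of kernels -/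

section Factorization

variable {d : ℕ} {H : Type w} [NormedAddCommGroup H] [InnerProductSpace ℂ H] [CompleteSpace H]

/-- The kernels `K_1, …, K_d` factor as `K_k(z,w) = Φ(z) P_k Φ(w)^*`, where `P_1, …, P_d` are
orthogonal projections with pairwise orthogonal ranges that sum up to the identity. -/
structure IsFactorization {V : Type u} [NormedAddCommGroup V] [InnerProductSpace ℂ V]
    [CompleteSpace V] (K : Fin d → PosKernel d V) (P : Fin d → (H →L[ℂ] H))
    (Φ : (Fin d → ℤ) → (H →L[ℂ] V)) : Prop where
  isStarProjection : ∀ k, IsStarProjection (P k)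
  orthogonal : ∀ j k, j ≠ k → P j * P k = 0
  sum_eq_one : ∑ k, P k = 1
  coeff_eq : ∀ k n m, (K k).coeff n m = Φ n ∘L P k ∘L ContinuousLinearMap.adjoint (Φ m)

namespace IsFactorization

section General

variable {V : Type u} [NormedAddCommGroup V] [InnerProductSpace ℂ V] [CompleteSpace V]
  {K : Fin d → PosKernel d V} {P : Fin d → (H →L[ℂ] H)} {Φ : (Fin d → ℤ) → (H →L[ℂ] V)}

theorem adjoint_proj (hF : IsFactorization K P Φ) (k : Fin d) :
    ContinuousLinearMap.adjoint (P k) = P k :=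
  (hF.isStarProjection k).isSelfAdjoint

theorem inner_proj_left (hF : IsFactorization K P Φ) (k : Fin d) (x y : H) :
    ⟪P k x, y⟫_ℂ = ⟪x, P k y⟫_ℂ := by
  conv_rhs => rw [← hF.adjoint_proj k, ContinuousLinearMap.adjoint_inner_right]

theorem proj_proj (hF : IsFactorization K P Φ) (k : Fin d) (x : H) : P k (P k x) = P k x :=
  DFunLike.congr_fun (hF.isStarProjection k).isIdempotentElem x

theorem proj_proj_of_ne (hF : IsFactorization K P Φ) {j k : Fin d} (h : j ≠ k) (x : H) :
    P j (P k x) = 0 :=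
  DFunLike.congr_fun (hF.orthogonal j k h) x

theorem proj_sum (hF : IsFactorization K P Φ) (k : Fin d) (f : Fin d → H) :
    P k (∑ j, P j (f j)) = P k (f k) := by
  rw [map_sum, Finset.sum_eq_single k (fun j _ hj => hF.proj_proj_of_ne hj.symm _)
    (fun h => absurd (Finset.mem_univ k) h), hF.proj_proj]

theorem sum_proj (hF : IsFactorization K P Φ) (x : H) : ∑ k, P k x = x := by
  have := DFunLike.congr_fun hF.sum_eq_one x
  simpa using this

/-- Pythagoras' theorem for the decomposition of `H` into the ranges of the projections. -/
theorem norm_sq_sum_proj (hF : IsFactorization K P Φ) (f : Fin d → H) :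
    ‖∑ k, P k (f k)‖ ^ 2 = ∑ k, ‖P k (f k)‖ ^ 2 := by
  have h : ⟪∑ k, P k (f k), ∑ k, P k (f k)⟫_ℂ = ∑ k, ⟪P k (f k), P k (f k)⟫_ℂ := by
    rw [sum_inner]
    refine Finset.sum_congr rfl fun k _ => ?_
    rw [← hF.proj_proj k, hF.inner_proj_left, hF.proj_sum, hF.inner_proj_left, hF.proj_proj,
      hF.inner_proj_left, hF.proj_proj]
  simp only [inner_self_eq_norm_sq_to_K] at h
  exact_mod_cast h

theorem shift_coeff_eq (hF : IsFactorization K P Φ) (k : Fin d) (s n m : Fin d → ℤ) :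
    ((K k).shift s).coeff n m =
      (Φ (n - s) ∘L P k) ∘L ContinuousLinearMap.adjoint (Φ (m - s) ∘L P k) := by
  rw [ContinuousLinearMap.adjoint_comp, hF.adjoint_proj]
  change (K k).coeff (n - s) (m - s) = _
  rw [hF.coeff_eq]
  ext x
  simp [hF.proj_proj]

theorem coeff_eq' (hF : IsFactorization K P Φ) (k : Fin d) (n m : Fin d → ℤ) :
    (K k).coeff n m = (Φ n ∘L P k) ∘L ContinuousLinearMap.adjoint (Φ m ∘L P k) := by
  rw [ContinuousLinearMap.adjoint_comp, hF.adjoint_proj, hF.coeff_eq]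
  ext x
  simp [hF.proj_proj]

/-- If `L(K_1, …, K_d) = {0}`, then `Φ(z) h = 0` implies `Φ(z) P_k h = 0` for all `k`. -/
theorem apply_proj_eq_zero (hF : IsFactorization K P Φ) (hK : overlappingSpace K = ⊥) {h : H}
    (hh : ∀ n, Φ n h = 0) (k : Fin d) (n : Fin d → ℤ) : Φ n (P k h) = 0 := by
  have := apply_eq_zero_of_overlappingSpace_eq_bot K hK (fun k n => Φ n ∘L P k) hF.coeff_eq'
    (fun _ => h) (Memℓp.all _) (fun n v => ?_) k n
  · exact this
  · convert! hasSum_fintype _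
    rw [← inner_sum]
    simp only [ContinuousLinearMap.comp_apply]
    rw [← map_sum, hF.sum_proj, hh, inner_zero_right]

/-- If `L(K'_1, …, K'_d) = {0}`, then `∑_k z_k Φ(z) P_k h = 0` implies `Φ(z) P_k h = 0` for
all `k`. -/
theorem apply_proj_eq_zero_of_shift (hF : IsFactorization K P Φ)
    (hK : overlappingSpace (fun k => (K k).shift (unitIdx k)) = ⊥) {h : H}
    (hh : ∀ n, ∑ k, Φ (n - unitIdx k) (P k h) = 0) (k : Fin d) (n : Fin d → ℤ) :
    Φ n (P k h) = 0 := by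
  have := apply_eq_zero_of_overlappingSpace_eq_bot _ hK (fun k n => Φ (n - unitIdx k) ∘L P k)
    (fun k => hF.shift_coeff_eq k (unitIdx k)) (fun _ => h) (Memℓp.all _) (fun n v => ?_) k
    (n + unitIdx k)
  · simpa using this
  · convert! hasSum_fintype _
    rw [← inner_sum]
    simp only [ContinuousLinearMap.comp_apply]
    rw [hh, inner_zero_right]

theorem inner_proj_adjoint (hF : IsFactorization K P Φ) (k l : Fin d) (n m : Fin d → ℤ)
    (x y : V) :
    ⟪P k (ContinuousLinearMap.adjoint (Φ n) x), P l (ContinuousLinearMap.adjoint (Φ m) y)⟫_ℂ =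
      if k = l then ⟪x, (K k).coeff n m y⟫_ℂ else 0 := by
  rw [hF.inner_proj_left]
  split_ifs with hkl
  · subst hkl
    rw [hF.proj_proj, ContinuousLinearMap.adjoint_inner_left, hF.coeff_eq]
    rfl
  · rw [hF.proj_proj_of_ne hkl, inner_zero_right]

end General

section Aug

variable {E : Type u} {Es : Type v}
  [NormedAddCommGroup E] [InnerProductSpace ℂ E] [CompleteSpace E]
  [NormedAddCommGroup Es] [InnerProductSpace ℂ Es] [CompleteSpace Es]
  {S : (Fin d → ℤ) → (E →L[ℂ] Es)} {K : Fin d → PosKernel d (WithLp 2 (Es × E))}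
  {P : Fin d → (H →L[ℂ] H)} {Φ : (Fin d → ℤ) → (H →L[ℂ] WithLp 2 (Es × E))}

/-- If `K_k(z,w)` has a vanishing diagonal coefficient in the direction `x`, then so does the
series `Φ(z) P_k h`, because `P_k Φ_n^* x = 0`. This transfers the support of the kernels to `Φ`. -/
theorem inner_apply_proj_eq_zero (hF : IsFactorization K P Φ) {k : Fin d} {n : Fin d → ℤ}
    {x : WithLp 2 (Es × E)} (hx : ⟪x, (K k).coeff n n x⟫_ℂ = 0) (h : H) :
    ⟪x, Φ n (P k h)⟫_ℂ = 0 := by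
  have h0 : P k (ContinuousLinearMap.adjoint (Φ n) x) = 0 := by
    rw [← inner_self_eq_zero (𝕜 := ℂ), hF.inner_proj_adjoint, if_pos rfl, hx]
  rw [← ContinuousLinearMap.adjoint_inner_left, ← hF.inner_proj_left, h0, inner_zero_left]

theorem fst_apply_eq_zero (hF : IsFactorization K P Φ) (hS : IsAugmentedAglerDecomposition S K)
    {n : Fin d → ℤ} (hn : ¬ 0 ≤ n) (h : H) : (Φ n h).fst = 0 := by
  rw [← hF.sum_proj h, map_sum]
  have hk : ∀ k, (Φ n (P k h)).fst = 0 := by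
    intro k
    refine ext_inner_left ℂ fun y => ?_
    have := hF.inner_apply_proj_eq_zero (k := k) (n := n) (x := WithLp.toLp 2 (y, 0))
      (by simp [WithLp.prod_inner_apply, hS.fst_support k n n _ hn]) h
    simpa [WithLp.prod_inner_apply] using this
  change WithLp.fstL 2 ℂ Es E _ = 0
  rw [map_sum]
  exact Finset.sum_eq_zero fun k _ => hk k

theorem snd_apply_proj_eq_zero (hF : IsFactorization K P Φ)
    (hS : IsAugmentedAglerDecomposition S K) {k : Fin d} {n : Fin d → ℤ}
    (hn : ¬ 0 ≤ -n - unitIdx k) (h : H) : (Φ n (P k h)).snd = 0 := by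
  refine ext_inner_left ℂ fun y => ?_
  have := hF.inner_apply_proj_eq_zero (k := k) (n := n) (x := WithLp.toLp 2 (0, y))
    (by simp [WithLp.prod_inner_apply, hS.snd_support k n n _ hn]) h
  simpa [WithLp.prod_inner_apply] using this

end Aug

end IsFactorization

end Factorization

/-! ### The lurking isometry relation -/

section Lurking

variable {d : ℕ} {H : Type w} {E : Type u} {Es : Type v}
  [NormedAddCommGroup H] [InnerProductSpace ℂ H]
  [NormedAddCommGroup E] [InnerProductSpace ℂ E] [CompleteSpace E]
  [NormedAddCommGroup Es] [InnerProductSpace ℂ Es] [CompleteSpace Es]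
  (S : (Fin d → ℤ) → (E →L[ℂ] Es)) (P : Fin d → (H →L[ℂ] H))
  (Φ : (Fin d → ℤ) → (H →L[ℂ] WithLp 2 (Es × E)))

/-- The coefficient of `z^n` in `Φ(z) h + [S(z); I] e`, for `x = (h, e)`. -/
noncomputable def inputSide (n : Fin d → ℤ) (x : WithLp 2 (H × E)) : WithLp 2 (Es × E) :=
  Φ n x.fst + WithLp.toLp 2 (S n x.snd, if n = 0 then x.snd else 0)

/-- The coefficient of `z^n` in `∑_k z_k Φ(z) P_k h + [I; S(z)^*] y`, for `x = (h, y)`. -/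
noncomputable def outputSide (n : Fin d → ℤ) (x : WithLp 2 (H × Es)) : WithLp 2 (Es × E) :=
  ∑ k, Φ (n - unitIdx k) (P k x.fst) +
    WithLp.toLp 2 (if n = 0 then x.snd else 0, ContinuousLinearMap.adjoint (S (-n)) x.snd)

theorem outputSide_sub (n : Fin d → ℤ) (x y : WithLp 2 (H × Es)) :
    outputSide S P Φ n (x - y) = outputSide S P Φ n x - outputSide S P Φ n y := by
  simp only [outputSide, WithLp.sub_fst, WithLp.sub_snd, map_sub, Finset.sum_sub_distrib]
  rw [add_sub_add_comm, ← WithLp.toLp_sub, Prod.mk_sub_mk]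
  congr 3
  split_ifs <;> simp

variable [CompleteSpace H] {S P Φ} {K : Fin d → PosKernel d (WithLp 2 (Es × E))}

/-- The input `e` is recovered from the constant term of `Φ(z) h + [S(z); I] e`, because the second
row of `Φ(z)` has no constant term. -/
theorem eq_zero_of_inputSide (hS : IsAugmentedAglerDecomposition S K)
    (hF : IsFactorization K P Φ) (hinj : ∀ h, (∀ n, Φ n h = 0) → h = 0)
    (x : WithLp 2 (H × E)) (hx : ∀ n, inputSide S Φ n x = 0) : x = 0 := by
  have he : x.snd = 0 := by
    have h0 := congrArg WithLp.snd (hx 0)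
    have h1 : (Φ 0 x.fst).snd = 0 := by
      rw [← hF.sum_proj x.fst, map_sum, WithLp.sum_snd]
      refine Finset.sum_eq_zero fun k _ => hF.snd_apply_proj_eq_zero hS ?_ _
      simp
    simpa [inputSide, h1] using h0
  have hh : x.fst = 0 := by
    refine hinj _ fun n => ?_
    have := hx n
    simp only [inputSide, he, map_zero, ite_self, Prod.mk_zero_zero, WithLp.toLp_zero,
      add_zero] at this
    simpa using this
  exact WithLp.prod_ext hh he

/-- The output `y` is recovered from the constant term of `∑_k z_k Φ(z) P_k h + [I; S(z)^*] y`,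
because the first row of `z_k Φ(z)` has no constant term. -/
theorem eq_zero_of_outputSide (hS : IsAugmentedAglerDecomposition S K)
    (hF : IsFactorization K P Φ) (hinj : ∀ h, (∀ n, Φ n h = 0) → h = 0)
    (hK : overlappingSpace (fun k => (K k).shift (unitIdx k)) = ⊥)
    (x : WithLp 2 (H × Es)) (hx : ∀ n, outputSide S P Φ n x = 0) : x = 0 := by
  have he : x.snd = 0 := by
    have h0 := congrArg WithLp.fst (hx 0)
    have h1 : (∑ k, Φ (0 - unitIdx k) (P k x.fst)).fst = 0 := by
      rw [WithLp.sum_fst]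
      refine Finset.sum_eq_zero fun k _ => hF.fst_apply_eq_zero hS ?_ _
      simp
    rw [outputSide, WithLp.add_fst, h1] at h0
    simpa using h0
  have hh : x.fst = 0 := by
    have hP := hF.apply_proj_eq_zero_of_shift hK (h := x.fst) fun n => by
      have := hx n
      simp only [outputSide, he, map_zero, ite_self, Prod.mk_zero_zero, WithLp.toLp_zero,
        add_zero] at this
      exact this
    rw [← hF.sum_proj x.fst]
    exact Finset.sum_eq_zero fun k _ => hinj _ (hP k)
  exact WithLp.prod_ext hh he

end Lurking

/-! ### Identities for unitary colligations -/

namespace GRColligation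

variable {d : ℕ} {H : Type w} {E : Type u} {Es : Type v}
  [NormedAddCommGroup H] [InnerProductSpace ℂ H] [CompleteSpace H]
  [NormedAddCommGroup E] [InnerProductSpace ℂ E] [CompleteSpace E]
  [NormedAddCommGroup Es] [InnerProductSpace ℂ Es] [CompleteSpace Es]
  (G : GRColligation d H E Es)

theorem isFactorization {K : Fin d → PosKernel d (WithLp 2 (Es × E))} (hG : G.Compatible K) :
    IsFactorization K G.P G.obs :=
  ⟨G.isStarProjection, G.orthogonal, G.sum_eq_one, hG⟩

theorem adjoint_P (k : Fin d) : ContinuousLinearMap.adjoint (G.P k) = G.P k :=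
  (G.isStarProjection k).isSelfAdjoint

theorem sum_P_apply (x : H) : ∑ k, G.P k x = x := by
  have := DFunLike.congr_fun G.sum_eq_one x
  simpa using this

theorem P_P_apply (k : Fin d) (x : H) : G.P k (G.P k x) = G.P k x :=
  DFunLike.congr_fun (G.isStarProjection k).isIdempotentElem x

theorem P_P_apply_of_ne {j k : Fin d} (h : j ≠ k) (x : H) : G.P j (G.P k x) = 0 :=
  DFunLike.congr_fun (G.orthogonal j k h) x

theorem U_toLp_zero_right (h : H) : G.U (WithLp.toLp 2 (h, 0)) = WithLp.toLp 2 (G.A h, G.C h) :=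
  rfl

theorem U_toLp_zero_left (e : E) : G.U (WithLp.toLp 2 (0, e)) = WithLp.toLp 2 (G.B e, G.D e) :=
  rfl

theorem U_toLp (h : H) (e : E) :
    G.U (WithLp.toLp 2 (h, e)) = WithLp.toLp 2 (G.A h + G.B e, G.C h + G.D e) := by
  have : (WithLp.toLp 2 (h, e) : WithLp 2 (H × E)) =
      WithLp.toLp 2 (h, 0) + WithLp.toLp 2 (0, e) := by
    rw [← WithLp.toLp_add]
    simp
  rw [this, map_add, U_toLp_zero_right, U_toLp_zero_left, ← WithLp.toLp_add]
  rfl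

/-- The inverse of `U` is the block matrix `[A^* C^*; B^* D^*]`. -/
theorem U_symm_toLp (h : H) (y : Es) :
    G.U.symm (WithLp.toLp 2 (h, y)) =
      WithLp.toLp 2 (ContinuousLinearMap.adjoint G.A h + ContinuousLinearMap.adjoint G.C y,
        ContinuousLinearMap.adjoint G.B h + ContinuousLinearMap.adjoint G.D y) := by
  refine ext_inner_left ℂ fun x => ?_
  obtain ⟨⟨g, e⟩, rfl⟩ := WithLp.toLp_surjective 2 x
  rw [← G.U.inner_map_map, G.U.apply_symm_apply, U_toLp]
  simp only [WithLp.prod_inner_apply, inner_add_left, inner_add_right,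
    ContinuousLinearMap.adjoint_inner_right]
  ring

theorem U_symm_U_toLp_zero_right (h : H) :
    ContinuousLinearMap.adjoint G.A (G.A h) + ContinuousLinearMap.adjoint G.C (G.C h) = h ∧
      ContinuousLinearMap.adjoint G.B (G.A h) + ContinuousLinearMap.adjoint G.D (G.C h) = 0 := by
  have := G.U.symm_apply_apply (WithLp.toLp 2 (h, 0))
  rw [U_toLp_zero_right, U_symm_toLp] at this
  exact ⟨congrArg WithLp.fst this, congrArg WithLp.snd this⟩

theorem U_U_symm_toLp_zero_right (h : H) :
    G.A (ContinuousLinearMap.adjoint G.A h) + G.B (ContinuousLinearMap.adjoint G.B h) = h ∧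
      G.C (ContinuousLinearMap.adjoint G.A h) + G.D (ContinuousLinearMap.adjoint G.B h) = 0 := by
  have := G.U.apply_symm_apply (WithLp.toLp 2 (h, 0))
  rw [U_symm_toLp, map_zero, map_zero, add_zero, add_zero, U_toLp] at this
  exact ⟨congrArg WithLp.fst this, congrArg WithLp.snd this⟩

theorem obs_fst (n : Fin d → ℤ) (h : H) : (G.obs n h).fst = G.C (G.fwd n h) := rfl

theorem obs_snd (n : Fin d → ℤ) (h : H) :
    (G.obs n h).snd =
      ∑ k, ContinuousLinearMap.adjoint G.B (G.bwd (-n - unitIdx k) (G.P k h)) := by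
  change (∑ k, ContinuousLinearMap.adjoint G.B ∘L G.bwd (-n - unitIdx k) ∘L G.P k) h = _
  simp

theorem obs_P_snd (n : Fin d → ℤ) (k : Fin d) (h : H) :
    (G.obs n (G.P k h)).snd =
      ContinuousLinearMap.adjoint G.B (G.bwd (-n - unitIdx k) (G.P k h)) := by
  rw [obs_snd, Finset.sum_eq_single k (fun j _ hj => ?_) (fun h => absurd (Finset.mem_univ k) h),
    P_P_apply]
  rw [G.P_P_apply_of_ne hj, map_zero, map_zero]

theorem sum_obs_sub_snd (n : Fin d → ℤ) (h : H) :
    ∑ k, (G.obs (n - unitIdx k) (G.P k h)).snd =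
      ContinuousLinearMap.adjoint G.B (G.bwd (-n) h) := by
  simp_rw [obs_P_snd]
  have : ∀ k : Fin d, -(n - unitIdx k) - unitIdx k = -n := fun k => by abel
  simp_rw [this]
  rw [← map_sum, ← map_sum, sum_P_apply]

theorem obs_fst_eq (n : Fin d → ℤ) (h : H) :
    (G.obs n h).fst =
      (if n = 0 then G.C h else 0) + ∑ k, (G.obs (n - unitIdx k) (G.P k (G.A h))).fst := by
  simp_rw [obs_fst]
  rw [fwd, resolventCoeff_eq_add_right]
  split_ifs <;> simp [fwd]

theorem sum_obs_sub_snd_eq (n : Fin d → ℤ) (h : H) :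
    ∑ k, (G.obs (n - unitIdx k) (G.P k h)).snd =
      (if n = 0 then ContinuousLinearMap.adjoint G.B h else 0) +
        (G.obs n (ContinuousLinearMap.adjoint G.A h)).snd := by
  rw [sum_obs_sub_snd, obs_snd, bwd, resolventCoeff_eq_add_right]
  simp only [neg_eq_zero]
  split_ifs <;> simp [bwd]

theorem transferCoeff_apply (n : Fin d → ℤ) (e : E) :
    G.transferCoeff n e =
      (if n = 0 then G.D e else 0) + ∑ k, (G.obs (n - unitIdx k) (G.P k (G.B e))).fst := by
  simp_rw [obs_fst]
  rw [transferCoeff]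
  split_ifs <;> simp

theorem adjoint_transferCoeff_apply (n : Fin d → ℤ) (y : Es) :
    ContinuousLinearMap.adjoint (G.transferCoeff (-n)) y =
      (if n = 0 then ContinuousLinearMap.adjoint G.D y else 0) +
        (G.obs n (ContinuousLinearMap.adjoint G.C y)).snd := by
  have h := DFunLike.congr_fun (sum_comp_adjoint_resolventCoeff G.P G.adjoint_P G.A (-n))
    (ContinuousLinearMap.adjoint G.C y)
  simp only [sum_apply, ContinuousLinearMap.comp_apply] at h
  rw [obs_snd, ← map_sum, transferCoeff]
  simp only [bwd]
  rw [← h, map_add, map_sum]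
  simp only [neg_eq_zero, ContinuousLinearMap.adjoint_comp, adjoint_P]
  split_ifs <;> simp [fwd]

/-- The defining relation of the colligation, read off from its observability series:
`∑_k z_k Π(z) P_k h' + [I; S(z)^*] y = Π(z) h + [S(z); I] e` whenever `(h', y) = U (h, e)`. -/
theorem outputSide_U {S : (Fin d → ℤ) → (E →L[ℂ] Es)} (hG : G.Realizes S) (n : Fin d → ℤ)
    (x : WithLp 2 (H × E)) : outputSide S G.P G.obs n (G.U x) = inputSide S G.obs n x := by
  apply WithLp.prod_ext
  · obtain ⟨⟨h, e⟩, rfl⟩ := WithLp.toLp_surjective 2 x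
    rw [U_toLp, outputSide, inputSide, ← hG n]
    simp only [WithLp.toLp_fst, WithLp.toLp_snd, WithLp.add_fst, WithLp.sum_fst, map_add,
      Finset.sum_add_distrib, G.obs_fst_eq n h,
      transferCoeff_apply]
    split_ifs
    · abel
    · abel
  -- The second row runs backward, so it is computed from `U x` by means of `U⁻¹`.
  · obtain ⟨⟨h, y⟩, hx⟩ := WithLp.toLp_surjective 2 (G.U x)
    obtain rfl : x = G.U.symm (WithLp.toLp 2 (h, y)) := by rw [hx, G.U.symm_apply_apply]
    rw [G.U.apply_symm_apply, U_symm_toLp, outputSide, inputSide, ← hG (-n)]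
    simp only [WithLp.toLp_fst, WithLp.toLp_snd, WithLp.add_snd, WithLp.sum_snd, map_add,
      sum_obs_sub_snd_eq,
      adjoint_transferCoeff_apply]
    split_ifs
    · abel
    · abel

end GRColligation

/-! ### The canonical state space -/

section Canonical

variable {d : ℕ} {V : Type u} [NormedAddCommGroup V] [InnerProductSpace ℂ V] [CompleteSpace V]

/-- The canonical state space `H(K_1) ⊕ ⋯ ⊕ H(K_d)`. -/
abbrev canonicalSpace (K : Fin d → PosKernel d V) : Type u := PiLp 2 fun k => (K k).space

/-- The projection of the canonical state space onto its `k`th summand. -/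
noncomputable def canonicalProj (K : Fin d → PosKernel d V) (k : Fin d) :
    canonicalSpace K →L[ℂ] canonicalSpace K :=
  ((PiLp.continuousLinearEquiv 2 ℂ fun k => (K k).space).symm :
      (∀ k, (K k).space) →L[ℂ] canonicalSpace K) ∘L
    ContinuousLinearMap.single ℂ (fun k => (K k).space) k ∘L
      PiLp.proj 2 (fun k => (K k).space) k

/-- The coefficient of `z^n` in the sum map `⊕_k f_k ↦ ∑_k f_k(z)`. -/
noncomputable def canonicalEval (K : Fin d → PosKernel d V) (n : Fin d → ℤ) :
    canonicalSpace K →L[ℂ] V :=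
  ∑ k, ContinuousLinearMap.adjoint (RKHS.kerFun (K k).space n) ∘L
    PiLp.proj 2 (fun k => (K k).space) k

variable (K : Fin d → PosKernel d V)

theorem canonicalProj_apply (k : Fin d) (f : canonicalSpace K) :
    canonicalProj K k f = PiLp.single 2 k (f k) := rfl

theorem canonicalEval_apply (n : Fin d → ℤ) (f : canonicalSpace K) :
    canonicalEval K n f = ∑ k, (f k) n := by
  simp [canonicalEval]

theorem canonicalEval_single (n : Fin d → ℤ) (k : Fin d) (f : (K k).space) :
    canonicalEval K n (PiLp.single 2 k f) = f n := by
  rw [canonicalEval_apply, Finset.sum_eq_single k]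
  · rw [PiLp.single_eq_same]
  · intro j _ hj
    rw [PiLp.single_eq_of_ne 2 hj, RKHS.coe_zero, Pi.zero_apply]
  · exact fun h => absurd (Finset.mem_univ k) h

theorem inner_canonical_single (k : Fin d) (g : (K k).space) (f : canonicalSpace K) :
    ⟪(PiLp.single 2 k g : canonicalSpace K), f⟫_ℂ = ⟪g, f k⟫_ℂ := by
  rw [PiLp.inner_apply, Finset.sum_eq_single k]
  · rw [PiLp.single_eq_same]
  · intro j _ hj
    rw [PiLp.single_eq_of_ne 2 hj, inner_zero_left]
  · exact fun h => absurd (Finset.mem_univ k) h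

theorem adjoint_canonicalEval_apply (m : Fin d → ℤ) (v : V) (k : Fin d) :
    ContinuousLinearMap.adjoint (canonicalEval K m) v k = RKHS.kerFun (K k).space m v := by
  refine ext_inner_left ℂ fun g => ?_
  rw [← inner_canonical_single, ContinuousLinearMap.adjoint_inner_right, canonicalEval_single,
    RKHS.inner_kerFun]

theorem isFactorization_canonical : IsFactorization K (canonicalProj K) (canonicalEval K) where
  isStarProjection k := by
    refine ⟨?_, ?_⟩
    · ext f : 1
      simp only [FunLike.coe_mul_eq_comp, Function.comp_apply, canonicalProj_apply,
        PiLp.single_eq_same]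
    · rw [ContinuousLinearMap.isSelfAdjoint_iff_isSymmetric]
      intro f g
      change ⟪canonicalProj K k f, g⟫_ℂ = ⟪f, canonicalProj K k g⟫_ℂ
      rw [canonicalProj_apply, canonicalProj_apply, inner_canonical_single,
        ← inner_conj_symm f, inner_canonical_single, inner_conj_symm]
  orthogonal j k hjk := by
    ext f : 1
    simp only [FunLike.coe_mul_eq_comp, Function.comp_apply, canonicalProj_apply]
    rw [PiLp.single_eq_of_ne 2 hjk]
    exact (PiLp.single_eq_zero_iff 2 j).2 rfl
  sum_eq_one := by
    ext f : 1
    refine PiLp.ext fun j => ?_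
    rw [sum_apply]
    simp only [canonicalProj_apply, WithLp.ofLp_sum, Finset.sum_apply, PiLp.ofLp_single,
      Finset.sum_pi_single]
    simp
  coeff_eq k n m := by
    ext v
    simp only [ContinuousLinearMap.comp_apply]
    rw [canonicalProj_apply, canonicalEval_single, adjoint_canonicalEval_apply, RKHS.kerFun_apply,
      RKHS.OfKernel.kernel_ofKernel]

/-- If `L(K_1, …, K_d) = {0}`, then the sum map is injective on the canonical state space. -/
theorem eq_zero_of_canonicalEval (hK : overlappingSpace K = ⊥) (f : canonicalSpace K)
    (hf : ∀ n, canonicalEval K n f = 0) : f = 0 := by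
  refine PiLp.ext fun k => RKHS.ext fun n => ?_
  rw [← canonicalEval_single, ← canonicalProj_apply,
    (isFactorization_canonical K).apply_proj_eq_zero hK hf]
  simp

end Canonical

/-! ### The lurking isometry argument -/

section Existence

variable {d : ℕ} {H : Type w} {E : Type u} {Es : Type v}
  [NormedAddCommGroup H] [InnerProductSpace ℂ H] [CompleteSpace H]
  [NormedAddCommGroup E] [InnerProductSpace ℂ E] [CompleteSpace E]
  [NormedAddCommGroup Es] [InnerProductSpace ℂ Es] [CompleteSpace Es]
  {S : (Fin d → ℤ) → (E →L[ℂ] Es)} {K : Fin d → PosKernel d (WithLp 2 (Es × E))}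
  {P : Fin d → (H →L[ℂ] H)} {Φ : (Fin d → ℤ) → (H →L[ℂ] WithLp 2 (Es × E))}

/-- The Agler decomposition, written as
`∑_k K_k + [S; I] [S; I]^* = ∑_k K'_k + [I; S^*] [I; S^*]^*`, says that the adjoints of the maps
`(h, e) ↦ Φ(z) h + [S; I] e` and `(h, y) ↦ ∑_k z_k Φ(z) P_k h + [I; S^*] y` have the same Gram
matrix. Both maps are injective, so they differ by a unitary map. -/
theorem exists_unitary_outputSide_eq_inputSide (hS : IsAugmentedAglerDecomposition S K)
    (hF : IsFactorization K P Φ) (hinj : ∀ h, (∀ n, Φ n h = 0) → h = 0)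
    (hK : overlappingSpace (fun k => (K k).shift (unitIdx k)) = ⊥) :
    ∃ U : WithLp 2 (H × E) ≃ₗᵢ[ℂ] WithLp 2 (H × Es),
      ∀ n x, outputSide S P Φ n (U x) = inputSide S Φ n x := by
  let a : (Fin d → ℤ) × WithLp 2 (Es × E) → WithLp 2 (H × E) := fun i =>
    WithLp.toLp 2 (ContinuousLinearMap.adjoint (Φ i.1) i.2,
      ContinuousLinearMap.adjoint (S i.1) i.2.fst + if i.1 = 0 then i.2.snd else 0)
  let b : (Fin d → ℤ) × WithLp 2 (Es × E) → WithLp 2 (H × Es) := fun i =>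
    WithLp.toLp 2 (∑ k, P k (ContinuousLinearMap.adjoint (Φ (i.1 - unitIdx k)) i.2),
      (if i.1 = 0 then i.2.fst else 0) + S (-i.1) i.2.snd)
  have ha : ∀ i x, ⟪a i, x⟫_ℂ = ⟪i.2, inputSide S Φ i.1 x⟫_ℂ := by
    intro i x
    simp only [a, inputSide, inner_add_right]
    simp only [WithLp.prod_inner_apply, WithLp.ofLp_fst, WithLp.ofLp_snd, inner_add_left,
      ContinuousLinearMap.adjoint_inner_left]
    split_ifs <;> simp
  have hb : ∀ i x, ⟪b i, x⟫_ℂ = ⟪i.2, outputSide S P Φ i.1 x⟫_ℂ := by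
    intro i x
    simp only [b, outputSide, inner_add_right, inner_sum]
    simp only [WithLp.prod_inner_apply, WithLp.ofLp_fst, WithLp.ofLp_snd, inner_add_left,
      sum_inner, hF.inner_proj_left,
      ContinuousLinearMap.adjoint_inner_left]
    simp only [ContinuousLinearMap.adjoint_inner_right]
    split_ifs <;> simp
  have hab : ∀ n i, inputSide S Φ n (a i) = outputSide S P Φ n (b i) := by
    rintro n ⟨m, v⟩
    have h1 : Φ n (ContinuousLinearMap.adjoint (Φ m) v) = ∑ k, (K k).coeff n m v := by
      conv_lhs => rw [← hF.sum_proj (ContinuousLinearMap.adjoint (Φ m) v), map_sum]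
      refine Finset.sum_congr rfl fun k _ => ?_
      rw [hF.coeff_eq]
      rfl
    have h2 : ∑ k, Φ (n - unitIdx k)
        (P k (∑ l, P l (ContinuousLinearMap.adjoint (Φ (m - unitIdx l)) v))) =
          ∑ k, ((K k).shift (unitIdx k)).coeff n m v := by
      refine Finset.sum_congr rfl fun k _ => ?_
      rw [hF.proj_sum]
      change _ = (K k).coeff (n - unitIdx k) (m - unitIdx k) v
      rw [hF.coeff_eq]
      rfl
    have h3 := hS.fst_eq n m v
    have h4 := hS.snd_eq n m v
    simp only [sub_apply, Finset.sum_sub_distrib, WithLp.sub_fst, WithLp.sub_snd]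
      at h3 h4
    simp only [inputSide, outputSide, a, b, h1, h2, WithLp.toLp_fst, WithLp.toLp_snd]
    apply WithLp.prod_ext
    · simp only [WithLp.add_fst, WithLp.toLp_fst]
      rw [sub_eq_iff_eq_add] at h3
      rw [h3, map_add]
      by_cases hn : n = 0 <;> by_cases hm : m = 0 <;> simp only [hn, hm, if_true, if_false,
        and_self, and_true, and_false, map_zero] <;> abel
    · simp only [WithLp.add_snd, WithLp.toLp_snd]
      rw [sub_eq_iff_eq_add] at h4
      rw [h4, map_add]
      by_cases hn : n = 0 <;> by_cases hm : m = 0 <;> simp only [hn, hm, if_true, if_false,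
        and_self, and_true, and_false, map_zero] <;> abel
  have ha0 : ∀ x, (∀ i, ⟪a i, x⟫_ℂ = 0) → x = 0 := fun x hx =>
    eq_zero_of_inputSide hS hF hinj x fun n => ext_inner_left ℂ fun v => by
      rw [← ha (n, v), hx, inner_zero_right]
  have hb0 : ∀ x, (∀ i, ⟪b i, x⟫_ℂ = 0) → x = 0 := fun x hx =>
    eq_zero_of_outputSide hS hF hinj hK x fun n => ext_inner_left ℂ fun v => by
      rw [← hb (n, v), hx, inner_zero_right]
  obtain ⟨U, hU⟩ := exists_linearIsometryEquiv_of_gram_eq a b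
    (fun i j => by rw [ha, hb, hab]) ha0 hb0
  refine ⟨U, fun n x => ext_inner_left ℂ fun v => ?_⟩
  rw [← hb (n, v), ← ha (n, v), ← hU, U.inner_map_map]

namespace GRColligation

/-- The relation between input and output sides determines the observability series of the
colligation: both rows of `Φ(z)` satisfy the recursion of a resolvent. -/
theorem obs_eq_of_outputSide_U (G : GRColligation d H E Es)
    (hS : IsAugmentedAglerDecomposition S K) (hF : IsFactorization K G.P Φ)
    (hU : ∀ n x, outputSide S G.P Φ n (G.U x) = inputSide S Φ n x) (n : Fin d → ℤ) :
    G.obs n = Φ n := by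
  ext h : 1
  apply WithLp.prod_ext
  · have := eq_comp_resolventCoeff (fun k => G.P k ∘L G.A) G.C
      (fun n => WithLp.fstL 2 ℂ Es E ∘L Φ n)
      (fun n hn => by ext h; exact hF.fst_apply_eq_zero hS hn h)
      (fun n => by
        ext h
        have := congrArg WithLp.fst (hU n (WithLp.toLp 2 (h, 0)))
        rw [U_toLp_zero_right] at this
        simp only [outputSide, inputSide, WithLp.add_fst, WithLp.sum_fst, WithLp.toLp_fst,
          WithLp.toLp_snd, map_zero, add_zero] at this
        simp only [ContinuousLinearMap.comp_apply, add_apply, sum_apply, WithLp.fstL_apply]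
        rw [← this, add_comm]
        split_ifs <;> rfl) n
    rw [obs_fst, fwd]
    exact (DFunLike.congr_fun this h).symm
  -- `Q` is the second row of `∑_k z_k Φ(z) P_k`, in powers of `z⁻¹`; it is `B^* (I - Z⁻¹ A^*)⁻¹`.
  · let Q : (Fin d → ℤ) → H →L[ℂ] E := fun m =>
      ∑ k, WithLp.sndL 2 ℂ Es E ∘L Φ (-m - unitIdx k) ∘L G.P k
    have hQ : ∀ m h, Q m h = ∑ k, (Φ (-m - unitIdx k) (G.P k h)).snd := by
      intro m h
      simp [Q]
    have hQP : ∀ m k h, Q (m - unitIdx k) (G.P k h) = (Φ (-m) (G.P k h)).snd := by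
      intro m k h
      rw [hQ, Finset.sum_eq_single k (fun j _ hj => ?_)
        (fun h => absurd (Finset.mem_univ k) h), G.P_P_apply]
      · congr 3
        abel
      · rw [G.P_P_apply_of_ne hj, map_zero]
        rfl
    have hsum : ∀ m h, ∑ k, Q (m - unitIdx k) (G.P k h) = (Φ (-m) h).snd := by
      intro m h
      simp_rw [hQP]
      rw [← WithLp.sum_snd, ← map_sum, G.sum_P_apply]
    have := eq_comp_resolventCoeff (fun k => G.P k ∘L ContinuousLinearMap.adjoint G.A)
      (ContinuousLinearMap.adjoint G.B) Q
      (fun m hm => by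
        ext h
        rw [hQ]
        refine Finset.sum_eq_zero fun k _ => hF.snd_apply_proj_eq_zero hS ?_ h
        simpa using hm)
      (fun m => by
        ext h
        have := congrArg WithLp.snd (hU (-m) (G.U.symm (WithLp.toLp 2 (h, 0))))
        rw [G.U.apply_symm_apply, U_symm_toLp] at this
        simp only [outputSide, inputSide, WithLp.add_snd, WithLp.sum_snd, WithLp.toLp_fst,
          WithLp.toLp_snd, map_zero, add_zero, neg_eq_zero] at this
        simp only [add_apply, sum_apply, ContinuousLinearMap.comp_apply]
        rw [hsum, hQ, this, add_comm]
        split_ifs <;> rfl)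
    rw [obs_snd]
    have h' := hsum (-n) h
    rw [neg_neg] at h'
    rw [← h']
    refine Finset.sum_congr rfl fun k _ => ?_
    exact (DFunLike.congr_fun (this (-n - unitIdx k)) (G.P k h)).symm

theorem realizes_of_outputSide_U (G : GRColligation d H E Es)
    (hS : IsAugmentedAglerDecomposition S K) (hF : IsFactorization K G.P Φ)
    (hU : ∀ n x, outputSide S G.P Φ n (G.U x) = inputSide S Φ n x) : G.Realizes S := by
  intro n
  ext e
  have := congrArg WithLp.fst (hU n (WithLp.toLp 2 (0, e)))
  rw [U_toLp_zero_left] at this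
  simp only [outputSide, inputSide, WithLp.add_fst, WithLp.sum_fst, WithLp.toLp_fst,
    WithLp.toLp_snd, map_zero, zero_add] at this
  rw [transferCoeff_apply, ← this, add_comm]
  simp_rw [G.obs_eq_of_outputSide_U hS hF hU]

end GRColligation

end Existence

/-! ### Close connectedness and uniqueness -/

theorem resolventCoeff_apply_mem {d : ℕ} {H : Type w} [NormedAddCommGroup H]
    [InnerProductSpace ℂ H] (T : Fin d → (H →L[ℂ] H)) (M : Submodule ℂ H)
    (hT : ∀ k, ∀ h ∈ M, T k h ∈ M) {h : H} (hh : h ∈ M) (n : Fin d → ℤ) :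
    resolventCoeff T n h ∈ M := by
  rw [resolventCoeff]
  generalize (∑ k, n k).toNat = N
  induction N generalizing n with
  | zero =>
    rw [pencilPowCoeff]
    split_ifs
    · exact hh
    · exact M.zero_mem
  | succ N ih =>
    rw [pencilPowCoeff, sum_apply]
    exact M.sum_mem fun k _ => hT k _ (ih _)

namespace GRColligation

variable {d : ℕ} {H : Type w} {H' : Type w'} {E : Type u} {Es : Type v}
  [NormedAddCommGroup H] [InnerProductSpace ℂ H] [CompleteSpace H]
  [NormedAddCommGroup H'] [InnerProductSpace ℂ H'] [CompleteSpace H']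
  [NormedAddCommGroup E] [InnerProductSpace ℂ E] [CompleteSpace E]
  [NormedAddCommGroup Es] [InnerProductSpace ℂ Es] [CompleteSpace Es]
  {G : GRColligation d H E Es} {G' : GRColligation d H' E Es}
  {S : (Fin d → ℤ) → (E →L[ℂ] Es)} {K : Fin d → PosKernel d (WithLp 2 (Es × E))}

theorem strictlyCloselyConnected_iff :
    G.StrictlyCloselyConnected ↔ ∀ h, (∀ n, G.obs n h = 0) → h = 0 := by
  constructor
  · intro hG h hh
    refine hG (funext fun n => ?_)
    simp [hh n]
  · intro hG h h' hh
    rw [← sub_eq_zero]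
    refine hG _ fun n => ?_
    rw [map_sub, sub_eq_zero]
    exact congrFun hh n

theorem C_apply_eq_obs (h : H) : G.C h = (G.obs 0 h).fst := by
  rw [obs_fst, fwd, resolventCoeff_of_sum_nonpos _ (by simp)]
  simp

theorem adjoint_B_apply_eq_sum_obs (h : H) :
    ContinuousLinearMap.adjoint G.B h = ∑ k, (G.obs (0 - unitIdx k) (G.P k h)).snd := by
  rw [sum_obs_sub_snd, bwd, resolventCoeff_of_sum_nonpos _ (by simp)]
  simp

/-- The orthogonal complement of an invariant subspace that contains `im B` and `im C^*` is
annihilated by `Π(z)`. -/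
theorem StrictlyCloselyConnected.closelyConnected (hG : G.StrictlyCloselyConnected) :
    G.CloselyConnected := by
  rw [strictlyCloselyConnected_iff] at hG
  intro M hM hB hC hA hA' hP
  have : CompleteSpace M := hM.completeSpace_coe
  rw [← Submodule.orthogonal_eq_bot_iff, Submodule.eq_bot_iff]
  intro h hh
  have hPo : ∀ k, ∀ x ∈ Mᗮ, G.P k x ∈ Mᗮ := by
    intro k x hx m hm
    rw [← G.adjoint_P k, ContinuousLinearMap.adjoint_inner_right]
    exact hx _ (hP k m hm)
  have hAo : ∀ x ∈ Mᗮ, G.A x ∈ Mᗮ := by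
    intro x hx m hm
    rw [← ContinuousLinearMap.adjoint_inner_left]
    exact hx _ (hA' m hm)
  have hAo' : ∀ x ∈ Mᗮ, ContinuousLinearMap.adjoint G.A x ∈ Mᗮ := by
    intro x hx m hm
    rw [ContinuousLinearMap.adjoint_inner_right]
    exact hx _ (hA m hm)
  have hCo : ∀ x ∈ Mᗮ, G.C x = 0 := by
    intro x hx
    refine ext_inner_left ℂ fun y => ?_
    rw [← ContinuousLinearMap.adjoint_inner_left, hx _ (hC y), inner_zero_right]
  have hBo : ∀ x ∈ Mᗮ, ContinuousLinearMap.adjoint G.B x = 0 := by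
    intro x hx
    refine ext_inner_left ℂ fun y => ?_
    rw [ContinuousLinearMap.adjoint_inner_right, hx _ (hB y), inner_zero_right]
  refine hG h fun n => WithLp.prod_ext ?_ ?_
  · exact hCo _ (resolventCoeff_apply_mem _ _ (fun k x hx => hPo k (G.A x) (hAo x hx)) hh n)
  · rw [obs_snd]
    refine Finset.sum_eq_zero fun k _ => hBo _ ?_
    exact resolventCoeff_apply_mem _ _
      (fun k x hx => hPo k (ContinuousLinearMap.adjoint G.A x) (hAo' x hx)) (hPo k h hh) _

/-- Since the kernels have no overlap, the kernel of `h ↦ Π(z) h` is invariant under `A`, `A^*` and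
the projections. It is orthogonal to `im B` and `im C^*`, so it is trivial if the colligation is
closely connected. -/
theorem CloselyConnected.strictlyCloselyConnected (hG : G.CloselyConnected)
    (hcomp : G.Compatible K) (hscc : IsStrictlyCloselyConnectedDecomposition K) :
    G.StrictlyCloselyConnected := by
  have hF := G.isFactorization hcomp
  let N : Submodule ℂ H := ⨅ n, LinearMap.ker (G.obs n).toLinearMap
  have hN : ∀ h, h ∈ N ↔ ∀ n, G.obs n h = 0 := by
    intro h
    simp [N]
  have hP : ∀ h ∈ N, ∀ k, G.P k h ∈ N := fun h hh k =>
    (hN _).2 (hF.apply_proj_eq_zero hscc.1 ((hN h).1 hh) k)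
  have hC : ∀ h ∈ N, G.C h = 0 := by
    intro h hh
    rw [C_apply_eq_obs, (hN h).1 hh]
    rfl
  have hB : ∀ h ∈ N, ContinuousLinearMap.adjoint G.B h = 0 := by
    intro h hh
    rw [adjoint_B_apply_eq_sum_obs]
    refine Finset.sum_eq_zero fun k _ => ?_
    rw [(hN _).1 (hP h hh k)]
    rfl
  have hA : ∀ h ∈ N, G.A h ∈ N := by
    intro h hh
    obtain ⟨h1, h2⟩ := G.U_symm_U_toLp_zero_right h
    rw [hC h hh, map_zero, add_zero] at h1 h2
    have hshift : ∀ n, ∑ k, G.obs (n - unitIdx k) (G.P k (G.A h)) = 0 := by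
      intro n
      apply WithLp.prod_ext
      · have := G.obs_fst_eq n h
        rw [hC h hh, ite_self, zero_add, (hN h).1 hh] at this
        rw [WithLp.sum_fst, ← this]
      · rw [WithLp.sum_snd, sum_obs_sub_snd_eq, h1, h2, (hN h).1 hh, ite_self, zero_add]
    rw [← G.sum_P_apply (G.A h)]
    exact N.sum_mem fun k _ => (hN _).2 (hF.apply_proj_eq_zero_of_shift hscc.2 hshift k)
  have hA' : ∀ h ∈ N, ContinuousLinearMap.adjoint G.A h ∈ N := by
    intro h hh
    obtain ⟨h1, h2⟩ := G.U_U_symm_toLp_zero_right h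
    rw [hB h hh, map_zero, add_zero] at h1 h2
    refine (hN _).2 fun n => WithLp.prod_ext ?_ ?_
    · rw [obs_fst_eq, h1, h2, ite_self, zero_add]
      refine Finset.sum_eq_zero fun k _ => ?_
      rw [(hN _).1 (hP h hh k)]
      rfl
    · have := G.sum_obs_sub_snd_eq n h
      rw [hB h hh, ite_self, zero_add] at this
      rw [← this]
      refine Finset.sum_eq_zero fun k _ => ?_
      rw [(hN _).1 (hP h hh k)]
      rfl
  have htop : Nᗮ = ⊤ := by
    refine hG Nᗮ N.isClosed_orthogonal (fun e h hh => ?_) (fun y h hh => ?_) (fun x hx h hh => ?_)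
      (fun x hx h hh => ?_) (fun k x hx h hh => ?_)
    · rw [← ContinuousLinearMap.adjoint_inner_left, hB h hh, inner_zero_left]
    · rw [ContinuousLinearMap.adjoint_inner_right, hC h hh, inner_zero_left]
    · rw [← ContinuousLinearMap.adjoint_inner_left]
      exact hx _ (hA' h hh)
    · rw [ContinuousLinearMap.adjoint_inner_right]
      exact hx _ (hA h hh)
    · rw [← G.adjoint_P k, ContinuousLinearMap.adjoint_inner_right]
      exact hx _ (hP h hh k)
  rw [strictlyCloselyConnected_iff]
  intro h hh
  have hmem : h ∈ Nᗮ := htop ▸ Submodule.mem_top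
  exact inner_self_eq_zero.1 (hmem h ((hN h).2 hh))

/-- The vectors `P_k Π_n^* v` are total and their Gram matrix is given by the kernels, which
provides the unitary map between the state spaces. It intertwines the colligation operators because
these are determined by the relation between input and output sides. -/
theorem unitarilyEquivalent (hS : IsAugmentedAglerDecomposition S K)
    (hK : overlappingSpace (fun k => (K k).shift (unitIdx k)) = ⊥)
    (hr : G.Realizes S) (hc : G.Compatible K) (hs : G.StrictlyCloselyConnected)
    (hr' : G'.Realizes S) (hc' : G'.Compatible K) (hs' : G'.StrictlyCloselyConnected) :
    G.UnitarilyEquivalent G' := by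
  rw [strictlyCloselyConnected_iff] at hs hs'
  have hF := G.isFactorization hc
  have hF' := G'.isFactorization hc'
  let a : (Fin d → ℤ) × Fin d × WithLp 2 (Es × E) → H := fun i =>
    G.P i.2.1 (ContinuousLinearMap.adjoint (G.obs i.1) i.2.2)
  let b : (Fin d → ℤ) × Fin d × WithLp 2 (Es × E) → H' := fun i =>
    G'.P i.2.1 (ContinuousLinearMap.adjoint (G'.obs i.1) i.2.2)
  have ha : ∀ x, (∀ i, ⟪a i, x⟫_ℂ = 0) → x = 0 := by
    intro x hx
    refine hs x fun n => ext_inner_left ℂ fun v => ?_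
    rw [← ContinuousLinearMap.adjoint_inner_left, ← hF.sum_proj (ContinuousLinearMap.adjoint _ v),
      sum_inner, inner_zero_right]
    exact Finset.sum_eq_zero fun k _ => hx (n, k, v)
  have hb : ∀ x, (∀ i, ⟪b i, x⟫_ℂ = 0) → x = 0 := by
    intro x hx
    refine hs' x fun n => ext_inner_left ℂ fun v => ?_
    rw [← ContinuousLinearMap.adjoint_inner_left,
      ← hF'.sum_proj (ContinuousLinearMap.adjoint _ v), sum_inner, inner_zero_right]
    exact Finset.sum_eq_zero fun k _ => hx (n, k, v)
  obtain ⟨W, hW⟩ := exists_linearIsometryEquiv_of_gram_eq a b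
    (fun i j => by simp only [a, b, hF.inner_proj_adjoint, hF'.inner_proj_adjoint]) ha hb
  have hWP : ∀ k h, W (G.P k h) = G'.P k (W h) := by
    intro k h
    rw [← sub_eq_zero]
    refine hb _ fun i => ?_
    have hPi : W (G.P k (a i)) = G'.P k (b i) := by
      by_cases hk : k = i.2.1
      · simp only [a, b, hk, G.P_P_apply, G'.P_P_apply]
        exact hW i
      · simp only [a, b, G.P_P_apply_of_ne hk, G'.P_P_apply_of_ne hk, map_zero]
    rw [inner_sub_right, ← hF'.inner_proj_left, ← hPi, ← hW, W.inner_map_map, W.inner_map_map,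
      hF.inner_proj_left k (a i), sub_self]
  have hobs : ∀ n h, G'.obs n (W h) = G.obs n h := by
    intro n h
    refine ext_inner_left ℂ fun v => ?_
    rw [← ContinuousLinearMap.adjoint_inner_left, ← ContinuousLinearMap.adjoint_inner_left,
      ← hF.sum_proj (ContinuousLinearMap.adjoint (G.obs n) v),
      ← hF'.sum_proj (ContinuousLinearMap.adjoint (G'.obs n) v), sum_inner, sum_inner]
    refine Finset.sum_congr rfl fun k _ => ?_
    have := hW (n, k, v)
    simp only [a, b] at this
    rw [← this, W.inner_map_map]
  refine ⟨W, hWP, fun h e => ?_⟩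
  rw [← sub_eq_zero]
  refine eq_zero_of_outputSide hS hF' hs' hK _ fun n => ?_
  rw [outputSide_sub, sub_eq_zero, G'.outputSide_U hr']
  have := G.outputSide_U hr n (WithLp.toLp 2 (h, e))
  simp only [outputSide, inputSide, WithLp.toLp_fst, WithLp.toLp_snd, ← hWP, hobs] at this ⊢
  exact this.symm

end GRColligation

/-! ### Shift-invariant sublattices -/

section Sublattice

variable {d : ℕ} {Ω Ω' : Set (Fin d → ℤ)}

theorem add_unitIdx_le_of_lt {q p : Fin d → ℤ} (h : q ≤ p) {k : Fin d} (hk : q k < p k) :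
    q + unitIdx k ≤ p := by
  intro i
  by_cases hi : i = k
  · subst hi
    simpa using hk
  · simpa [hi] using h i

theorem IsShiftInvariant.isUpperSet (hΩ : IsShiftInvariant Ω) : IsUpperSet Ω := by
  have key : ∀ (N : ℕ) (q p : Fin d → ℤ), q ≤ p → ∑ i, p i = ∑ i, q i + N → q ∈ Ω → p ∈ Ω := by
    intro N
    induction N with
    | zero =>
      intro q p hqp hsum hq
      have : q = p := funext fun i =>
        (Finset.sum_eq_sum_iff_of_le fun i _ => hqp i).1 (by simpa using hsum.symm) i
          (Finset.mem_univ i)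
      exact this ▸ hq
    | succ N ih =>
      intro q p hqp hsum hq
      obtain ⟨k, -, hk⟩ := Finset.exists_lt_of_sum_lt (s := Finset.univ) (f := q) (g := p)
        (by push_cast at hsum; omega)
      refine ih (q + unitIdx k) p (add_unitIdx_le_of_lt hqp hk) ?_ (hΩ q hq k)
      simp only [Pi.add_apply, Finset.sum_add_distrib, Finset.sum_pi_single', Finset.mem_univ,
        if_true]
      push_cast at hsum
      omega
  intro q p hqp hq
  have hle : ∑ i, q i ≤ ∑ i, p i := Finset.sum_le_sum fun i _ => hqp i
  refine key (∑ i, p i - ∑ i, q i).toNat q p hqp ?_ hq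
  omega

theorem update_sub_one (n : Fin d → ℤ) (k : Fin d) :
    Function.update n k (n k - 1) = n - unitIdx k := by
  ext i
  by_cases hi : i = k
  · subst hi
    simp
  · simp [hi]

theorem IsShiftInvariant.mem_finBoundary_iff (hΩ : IsShiftInvariant Ω) {n : Fin d → ℤ}
    {k : Fin d} : n ∈ finBoundary Ω k ↔ n ∈ Ω ∧ n - unitIdx k ∉ Ω := by
  constructor
  · rintro ⟨h1, h2⟩
    refine ⟨by simpa using h1, fun h3 => ?_⟩
    rw [← update_sub_one] at h3
    have := h2 h3
    omega
  · rintro ⟨h1, h2⟩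
    refine ⟨by simpa using h1, fun t ht => ?_⟩
    by_contra hlt
    refine h2 (hΩ.isUpperSet ?_ ht)
    rw [← update_sub_one]
    exact update_le_update_iff.2 ⟨by omega, fun _ _ => le_rfl⟩

theorem IsShiftInvariant.hasBoundedPast (hΩ : IsShiftInvariant Ω) (hb : HasNoInfiniteBoundary Ω) :
    HasBoundedPast Ω := by
  intro p
  choose t ht using fun k => (hb p k).2
  refine ⟨t, fun q hq hqp k => ?_⟩
  by_contra hlt
  refine ht k (hΩ.isUpperSet ?_ hq)
  intro i
  by_cases hi : i = k
  · subst hi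
    rw [Function.update_self]
    exact (not_le.1 hlt).le
  · simpa [hi] using hqp i

/-- The complement of `-Ω`, which turns backward recursions outside `Ω` into forward ones. -/
def latticeReflection (Ω : Set (Fin d → ℤ)) : Set (Fin d → ℤ) := {n | -n ∉ Ω}

theorem IsShiftInvariant.reflection (hΩ : IsShiftInvariant Ω) :
    IsShiftInvariant (latticeReflection Ω) := by
  intro n hn k h
  refine hn ?_
  have := hΩ _ h k
  simpa using this

theorem HasNoInfiniteBoundary.reflection (hΩ : HasNoInfiniteBoundary Ω) :
    HasNoInfiniteBoundary (latticeReflection Ω) := by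
  intro n k
  have h : ∀ t, -Function.update n k t = Function.update (-n) k (-t) := fun t => by
    ext i
    by_cases hi : i = k
    · subst hi
      simp
    · simp [hi]
  obtain ⟨⟨t, ht⟩, s, hs⟩ := hΩ (-n) k
  refine ⟨⟨-s, ?_⟩, -t, ?_⟩
  · change -_ ∉ Ω
    rwa [h, neg_neg]
  · change ¬ (-_ ∉ Ω)
    rw [h, neg_neg]
    exact not_not_intro ht

theorem IsShiftInvariant.inter (hΩ : IsShiftInvariant Ω) (hΩ' : IsShiftInvariant Ω') :
    IsShiftInvariant (Ω ∩ Ω') :=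
  fun n hn k => ⟨hΩ n hn.1 k, hΩ' n hn.2 k⟩

theorem HasNoInfiniteBoundary.inter (hΩ : IsShiftInvariant Ω) (hΩ' : IsShiftInvariant Ω')
    (hb : HasNoInfiniteBoundary Ω) (hb' : HasNoInfiniteBoundary Ω') :
    HasNoInfiniteBoundary (Ω ∩ Ω') := by
  intro n k
  obtain ⟨⟨t, ht⟩, s, hs⟩ := hb n k
  obtain ⟨⟨t', ht'⟩, -⟩ := hb' n k
  refine ⟨⟨max t t', ?_, ?_⟩, s, fun h => hs h.1⟩
  · exact hΩ.isUpperSet (update_le_update_iff.2 ⟨le_max_left _ _, fun _ _ => le_rfl⟩) ht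
  · exact hΩ'.isUpperSet
      (update_le_update_iff.2 ⟨le_max_right _ _, fun _ _ => le_rfl⟩) ht'

/-! ### Conservation of energy -/

/-- The pairs `(k, n)` for which the edge from `n - e_k` to `n` enters `Ω`. -/
def enteringEdges (Ω : Set (Fin d → ℤ)) : Set (Fin d × (Fin d → ℤ)) :=
  {p | p.2 ∈ Ω ∧ p.2 - unitIdx p.1 ∉ Ω}

/-- For a divergence-free nonnegative flow `a` on the edges of the lattice, the flow into a smaller
set `Ω` is bounded by the flow into `Ω'`. Here `a (k, n)` is the flow along the edge from `n - e_k`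
to `n`. The finitely many edges in `F` are fed by the finite set `R` of their predecessors in
`Ω' \ Ω`, and the flow into `R` from outside `R` comes from outside `Ω'`. -/
theorem sum_enteringEdges_le_of_subset {a : Fin d × (Fin d → ℤ) → ℝ} (ha : ∀ p, 0 ≤ a p)
    (hflow : ∀ n, ∑ k, a (k, n) = ∑ k, a (k, n + unitIdx k)) (hΩ : IsUpperSet Ω)
    (hΩ' : HasBoundedPast Ω') (hsub : Ω ⊆ Ω') {c : ℝ}
    (hc : ∀ F : Finset (Fin d × (Fin d → ℤ)), ↑F ⊆ enteringEdges Ω' → ∑ p ∈ F, a p ≤ c)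
    (F : Finset (Fin d × (Fin d → ℤ))) (hF : ↑F ⊆ enteringEdges Ω) : ∑ p ∈ F, a p ≤ c := by
  classical
  have hfin : {q | q ∈ Ω' ∧ q ∉ Ω ∧ ∃ p ∈ F, q ≤ p.2}.Finite := by
    choose b hb using hΩ'
    refine (F.finite_toSet.biUnion fun p _ => Set.finite_Icc (b p.2) p.2).subset ?_
    rintro q ⟨hq, -, p, hp, hqp⟩
    exact Set.mem_biUnion hp ⟨hb _ q hq hqp, hqp⟩
  set R := hfin.toFinset
  have hmem : ∀ q, q ∈ R ↔ q ∈ Ω' ∧ q ∉ Ω ∧ ∃ p ∈ F, q ≤ p.2 := fun q =>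
    hfin.mem_toFinset
  let I : Finset (Fin d × (Fin d → ℤ)) := Finset.univ ×ˢ R
  let φ : Fin d × (Fin d → ℤ) ↪ Fin d × (Fin d → ℤ) :=
    ⟨fun p => (p.1, p.2 + unitIdx p.1), by
      rintro ⟨k, n⟩ ⟨l, m⟩ h
      obtain ⟨rfl, h2⟩ := Prod.mk.inj h
      simpa using h2⟩
  have hbalance : ∑ p ∈ I, a p = ∑ p ∈ I.map φ, a p := by
    rw [Finset.sum_map, Finset.sum_product_right, Finset.sum_product_right]
    exact Finset.sum_congr rfl fun n _ => hflow n
  have hout : ∀ p : Fin d × (Fin d → ℤ), p.2 - unitIdx p.1 ∈ R → p ∈ I.map φ := by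
    intro p hp
    rw [Finset.mem_map]
    exact ⟨(p.1, p.2 - unitIdx p.1), by simp [I, hp], Prod.ext rfl (sub_add_cancel _ _)⟩
  have hdisj : Disjoint F I := by
    rw [Finset.disjoint_left]
    intro p hpF hpI
    exact ((hmem _).1 (Finset.mem_product.1 hpI).2).2.1 (hF hpF).1
  have hin : ↑((F ∪ I) \ I.map φ) ⊆ enteringEdges Ω' := by
    intro p hp
    rw [Finset.mem_coe, Finset.mem_sdiff, Finset.mem_union] at hp
    obtain ⟨hp1, hp2⟩ := hp
    rcases hp1 with hp1 | hp1
    · refine ⟨hsub (hF hp1).1, fun h => hp2 (hout p ((hmem _).2 ⟨h, (hF hp1).2, p, hp1, ?_⟩))⟩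
      exact sub_unitIdx_le _ _
    · obtain ⟨h1, h2, q, hq, hpq⟩ := (hmem _).1 (Finset.mem_product.1 hp1).2
      refine ⟨h1, fun h => hp2 (hout p ((hmem _).2 ⟨h, fun h' => h2 ?_, q, hq, ?_⟩))⟩
      · exact hΩ (sub_unitIdx_le _ _) h'
      · exact (sub_unitIdx_le _ _).trans hpq
  have hle : ∑ p ∈ F, a p + ∑ p ∈ I, a p ≤
      ∑ p ∈ (F ∪ I) \ I.map φ, a p + ∑ p ∈ I.map φ, a p := by
    rw [← Finset.sum_union hdisj, ← Finset.sum_union Finset.sdiff_disjoint]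
    refine Finset.sum_le_sum_of_subset_of_nonneg ?_ fun p _ _ => ha p
    rw [Finset.sdiff_union_self_eq_union]
    exact Finset.subset_union_left
  have := hc _ hin
  linarith

/-- The same bound for a larger set `Ω`, obtained by reflecting the lattice. -/
theorem sum_enteringEdges_le_of_superset {a : Fin d × (Fin d → ℤ) → ℝ} (ha : ∀ p, 0 ≤ a p)
    (hflow : ∀ n, ∑ k, a (k, n) = ∑ k, a (k, n + unitIdx k)) (hΩ : IsShiftInvariant Ω)
    (hΩ' : IsShiftInvariant Ω') (hb' : HasNoInfiniteBoundary Ω') (hsub : Ω' ⊆ Ω) {c : ℝ}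
    (hc : ∀ F : Finset (Fin d × (Fin d → ℤ)), ↑F ⊆ enteringEdges Ω' → ∑ p ∈ F, a p ≤ c)
    (F : Finset (Fin d × (Fin d → ℤ))) (hF : ↑F ⊆ enteringEdges Ω) : ∑ p ∈ F, a p ≤ c := by
  let ψ : Fin d × (Fin d → ℤ) ↪ Fin d × (Fin d → ℤ) :=
    ⟨fun p => (p.1, unitIdx p.1 - p.2), by
      rintro ⟨k, n⟩ ⟨l, m⟩ h
      obtain ⟨rfl, h2⟩ := Prod.mk.inj h
      simpa using h2⟩
  have hψ : ∀ p, ψ (ψ p) = p := fun p => Prod.ext rfl (sub_sub_cancel _ _)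
  have hedge : ∀ (Θ : Set (Fin d → ℤ)) (p : Fin d × (Fin d → ℤ)),
      p ∈ enteringEdges Θ → ψ p ∈ enteringEdges (latticeReflection Θ) := by
    rintro Θ ⟨k, n⟩ ⟨h1, h2⟩
    refine ⟨?_, ?_⟩
    · change -(unitIdx k - n) ∉ Θ
      rwa [neg_sub]
    · change ¬ (-(unitIdx k - n - unitIdx k) ∉ Θ)
      rw [not_not]
      convert! h1 using 1
      simp
  have hedge' : ∀ (Θ : Set (Fin d → ℤ)) (p : Fin d × (Fin d → ℤ)),
      p ∈ enteringEdges (latticeReflection Θ) → ψ p ∈ enteringEdges Θ := by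
    rintro Θ ⟨k, n⟩ ⟨h1, h2⟩
    refine ⟨?_, ?_⟩
    · have : -(n - unitIdx k) ∈ Θ := not_not.1 h2
      rwa [neg_sub] at this
    · change unitIdx k - n - unitIdx k ∉ Θ
      have : -n ∉ Θ := h1
      convert! this using 1
      simp
  have h := sum_enteringEdges_le_of_subset (a := fun p => a (ψ p)) (fun p => ha _)
    (fun n => ?_) hΩ.reflection.isUpperSet
    (hΩ'.reflection.hasBoundedPast hb'.reflection)
    (fun n hn h => hn (hsub h)) (c := c) (fun F' hF' => ?_) (F.map ψ) ?_
  · simpa [hψ] using h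
  · have h1 : ∀ k, ψ (k, n) = (k, -n + unitIdx k) := fun k =>
      Prod.ext rfl (sub_eq_neg_add _ _)
    have h2 : ∀ k, ψ (k, n + unitIdx k) = (k, -n) := fun k =>
      Prod.ext rfl (sub_add_cancel_right _ _)
    simp_rw [h1, h2]
    exact (hflow (-n)).symm
  · have := hc (F'.map ψ) fun p hp => by
      obtain ⟨q, hq, rfl⟩ := Finset.mem_map.1 (Finset.mem_coe.1 hp)
      exact hedge' _ q (hF' hq)
    rwa [Finset.sum_map] at this
  · intro p hp
    obtain ⟨q, hq, rfl⟩ := Finset.mem_map.1 (Finset.mem_coe.1 hp)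
    exact hedge _ q (hF hq)

theorem summable_boundaryIndex_iff (hΩ : IsShiftInvariant Ω) {a : Fin d × (Fin d → ℤ) → ℝ}
    (ha : ∀ p, 0 ≤ a p) :
    Summable (fun j : BoundaryIndex Ω => a (j.1, j.2)) ↔
      ∃ c, ∀ F : Finset (Fin d × (Fin d → ℤ)), ↑F ⊆ enteringEdges Ω → ∑ p ∈ F, a p ≤ c := by
  classical
  let e : BoundaryIndex Ω ≃ enteringEdges Ω :=
    { toFun j := ⟨(j.1, j.2), hΩ.mem_finBoundary_iff.1 j.2.2⟩
      invFun p := ⟨p.1.1, p.1.2, hΩ.mem_finBoundary_iff.2 p.2⟩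
      left_inv _ := rfl
      right_inv _ := rfl }
  have h1 : Summable (fun j : BoundaryIndex Ω => a (j.1, j.2)) ↔
      Summable ((enteringEdges Ω).indicator a) := by
    rw [← summable_subtype_iff_indicator, ← e.summable_iff]
    rfl
  have h0 : ∀ p, 0 ≤ (enteringEdges Ω).indicator a p :=
    fun p => Set.indicator_nonneg (fun p _ => ha p) p
  rw [h1]
  constructor
  · intro h
    refine ⟨∑' p, (enteringEdges Ω).indicator a p, fun F hF => ?_⟩
    refine le_trans (le_of_eq ?_) (h.sum_le_tsum F fun p _ => h0 p)
    exact Finset.sum_congr rfl fun p hp => (Set.indicator_of_mem (hF hp) a).symm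
  · rintro ⟨c, hc⟩
    refine summable_of_sum_le (c := c) h0 fun F => ?_
    simp_rw [Set.indicator_apply]
    rw [← Finset.sum_filter]
    exact hc _ fun p hp => (Finset.mem_filter.1 hp).2

/-- For a divergence-free nonnegative flow, the total flow through the boundary is finite for one
set without boundary at infinity if it is finite for another. -/
theorem summable_boundaryIndex_of_summable (hΩ : IsShiftInvariant Ω)
    (hb : HasNoInfiniteBoundary Ω) (hΩ' : IsShiftInvariant Ω') (hb' : HasNoInfiniteBoundary Ω')
    {a : Fin d × (Fin d → ℤ) → ℝ} (ha : ∀ p, 0 ≤ a p)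
    (hflow : ∀ n, ∑ k, a (k, n) = ∑ k, a (k, n + unitIdx k))
    (h : Summable (fun j : BoundaryIndex Ω' => a (j.1, j.2))) :
    Summable (fun j : BoundaryIndex Ω => a (j.1, j.2)) := by
  rw [summable_boundaryIndex_iff hΩ' ha] at h
  rw [summable_boundaryIndex_iff hΩ ha]
  obtain ⟨c, hc⟩ := h
  have hi := hΩ.inter hΩ'
  exact ⟨c, sum_enteringEdges_le_of_superset ha hflow hΩ hi (hb.inter hΩ hΩ' hb')
    Set.inter_subset_left (sum_enteringEdges_le_of_subset ha hflow hi.isUpperSet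
      (hΩ'.hasBoundedPast hb') Set.inter_subset_right hc)⟩

end Sublattice

/-! ### Responses to distributed initial data -/

section Response

variable {d : ℕ} {H : Type w} [NormedAddCommGroup H] [InnerProductSpace ℂ H]
  (T : Fin d → (H →L[ℂ] H)) {J : Type*} (m : J → Fin d → ℤ) (x : J → H)

/-- The coefficient of `z^n` in `(I - ∑_k z_k T_k)⁻¹ ∑_j x_j z^{m_j}`. -/
noncomputable def response (n : Fin d → ℤ) : H := ∑' j, resolventCoeff T (n - m j) (x j)

variable {m}

theorem hasSum_response (hm : ∀ n, {j | m j ≤ n}.Finite) (n : Fin d → ℤ) :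
    HasSum (fun j => resolventCoeff T (n - m j) (x j)) (response T m x n) := by
  refine (summable_of_hasFiniteSupport ((hm n).subset fun j hj => ?_)).hasSum
  by_contra hlt
  refine hj ?_
  change resolventCoeff T (n - m j) (x j) = 0
  rw [resolventCoeff_eq_zero T fun h => hlt (sub_nonneg.1 h)]
  rfl

/-- The response is the solution of the recursion with the distributed source `∑_j x_j z^{m_j}`. -/
theorem response_eq (hm : ∀ n, {j | m j ≤ n}.Finite) {n : Fin d → ℤ} {s : H}
    (hs : HasSum (fun j => if m j = n then x j else 0) s) :
    response T m x n = s + ∑ k, T k (response T m x (n - unitIdx k)) := by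
  refine (hasSum_response T x hm n).unique ?_
  have h := hs.add (hasSum_sum (s := Finset.univ) fun k _ =>
    (T k).hasSum (hasSum_response T x hm (n - unitIdx k)))
  convert! h using 2 with j
  rw [resolventCoeff_eq_add_left, add_apply, sum_apply]
  congr 1
  · by_cases hj : m j = n
    · simp [hj]
    · have : n - m j ≠ 0 := fun h => hj (sub_eq_zero.1 h).symm
      simp [hj, this]
  · refine Finset.sum_congr rfl fun k _ => ?_
    rw [sub_right_comm]
    rfl

theorem response_eq_zero {Ω : Set (Fin d → ℤ)} (hΩ : IsUpperSet Ω) (hm : ∀ j, m j ∈ Ω)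
    {n : Fin d → ℤ} (hn : n ∉ Ω) : response T m x n = 0 := by
  refine (tsum_congr fun j => ?_).trans tsum_zero
  rw [resolventCoeff_eq_zero T fun h => hn (hΩ (sub_nonneg.1 h) (hm j))]
  rfl

theorem HasBoundedPast.finite_setOf_le {Ω : Set (Fin d → ℤ)} (hΩ : HasBoundedPast Ω)
    (hm : ∀ j, m j ∈ Ω) (κ : J → Fin d) (hinj : Function.Injective fun j => (κ j, m j))
    (n : Fin d → ℤ) : {j | m j ≤ n}.Finite := by
  obtain ⟨b, hb⟩ := hΩ n
  refine Set.Finite.subset ((Set.finite_univ.prod (Set.finite_Icc b n)).preimage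
    (hinj.injOn (s := (fun j => (κ j, m j)) ⁻¹' (Set.univ ×ˢ Set.Icc b n)))) ?_
  intro j hj
  exact ⟨trivial, hb _ (hm j) hj, hj⟩

end Response

/-! ### Boundary data -/

section BoundaryData

variable {d : ℕ} {H : Type w} [NormedAddCommGroup H] {Ω : Set (Fin d → ℤ)}

/-- The boundary datum at `(k, n)`, extended by zero off the `k`-boundary of `Ω`. -/
noncomputable def boundaryValue (x : BoundaryIndex Ω → H) (k : Fin d) (n : Fin d → ℤ) : H :=
  open Classical in if h : n ∈ finBoundary Ω k then x ⟨k, n, h⟩ else 0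

/-- Summing the data over the boundary points singled out by one equation in each direction `k`. -/
theorem hasSum_boundaryValue (x : BoundaryIndex Ω → H) (g : Fin d → Fin d → ℤ) :
    HasSum (fun j : BoundaryIndex Ω => if (j.2 : Fin d → ℤ) = g j.1 then x j else 0)
      (∑ k, boundaryValue x k (g k)) := by
  classical
  have h : ∀ k, HasSum (fun j : BoundaryIndex Ω =>
      if j.1 = k ∧ (j.2 : Fin d → ℤ) = g k then x j else 0) (boundaryValue x k (g k)) := by
    intro k
    by_cases hk : g k ∈ finBoundary Ω k
    · have hv : boundaryValue x k (g k) = (fun j : BoundaryIndex Ω =>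
          if j.1 = k ∧ (j.2 : Fin d → ℤ) = g k then x j else 0) ⟨k, g k, hk⟩ := by
        simp [boundaryValue, hk]
      rw [hv]
      refine hasSum_single _ ?_
      rintro ⟨l, n, hn⟩ hne
      refine if_neg ?_
      rintro ⟨h1, h2⟩
      simp only at h1 h2
      subst h1
      subst h2
      exact hne rfl
    · rw [boundaryValue, dif_neg hk]
      convert! hasSum_zero with j
      refine if_neg ?_
      rintro ⟨h1, h2⟩
      refine hk ?_
      rw [← h2, ← h1]
      exact j.2.2
  convert! hasSum_sum (s := Finset.univ) fun k _ => h k using 2 with j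
  rw [Finset.sum_eq_single j.1]
  · simp
  · intro k _ hk
    exact if_neg fun h => hk h.1.symm
  · exact fun h => absurd (Finset.mem_univ _) h

theorem IsShiftInvariant.boundaryIndex_mem (hΩ : IsShiftInvariant Ω) (j : BoundaryIndex Ω) :
    (j.2 : Fin d → ℤ) ∈ Ω :=
  (hΩ.mem_finBoundary_iff.1 j.2.2).1

theorem IsShiftInvariant.boundaryIndex_mem_reflection (hΩ : IsShiftInvariant Ω)
    (j : BoundaryIndex Ω) : unitIdx j.1 - (j.2 : Fin d → ℤ) ∈ latticeReflection Ω := by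
  change -_ ∉ Ω
  rw [neg_sub]
  exact (hΩ.mem_finBoundary_iff.1 j.2.2).2

theorem finite_setOf_boundaryIndex_le (hΩ : IsShiftInvariant Ω) (hb : HasNoInfiniteBoundary Ω)
    (n : Fin d → ℤ) : {j : BoundaryIndex Ω | (j.2 : Fin d → ℤ) ≤ n}.Finite := by
  refine (hΩ.hasBoundedPast hb).finite_setOf_le hΩ.boundaryIndex_mem (fun j => j.1) ?_ n
  rintro ⟨k, p, hp⟩ ⟨l, q, hq⟩ h
  obtain ⟨rfl, h2⟩ := Prod.mk.inj h
  obtain rfl : p = q := h2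
  rfl

theorem finite_setOf_reflected_boundaryIndex_le (hΩ : IsShiftInvariant Ω)
    (hb : HasNoInfiniteBoundary Ω) (n : Fin d → ℤ) :
    {j : BoundaryIndex Ω | unitIdx j.1 - (j.2 : Fin d → ℤ) ≤ n}.Finite := by
  refine (hΩ.reflection.hasBoundedPast hb.reflection).finite_setOf_le
    hΩ.boundaryIndex_mem_reflection (fun j => j.1) ?_ n
  rintro ⟨k, p, hp⟩ ⟨l, q, hq⟩ h
  obtain ⟨rfl, h2⟩ := Prod.mk.inj h
  obtain rfl : p = q := sub_right_injective h2
  rfl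

end BoundaryData

/-! ### Null trajectories -/

namespace GRColligation

variable {d : ℕ} {H : Type w} {E : Type u} {Es : Type v}
  [NormedAddCommGroup H] [InnerProductSpace ℂ H] [CompleteSpace H]
  [NormedAddCommGroup E] [InnerProductSpace ℂ E] [CompleteSpace E]
  [NormedAddCommGroup Es] [InnerProductSpace ℂ Es] [CompleteSpace Es]
  (G : GRColligation d H E Es) {Ω : Set (Fin d → ℤ)}

/-- A null trajectory: a solution on the whole lattice of the system equations
`P_k x(n + e_k) = P_k (A x(n) + B u(n))`, `y(n) = C x(n) + D u(n)` with input `u = 0` and output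
`y = 0`. -/
def IsNullTrajectory (x : (Fin d → ℤ) → H) : Prop :=
  ∀ n, G.U (WithLp.toLp 2 (x n, 0)) = WithLp.toLp 2 (∑ k, G.P k (x (n + unitIdx k)), 0)

/-- The states inside `Ω` that evolve forward, with zero input, from data on the boundary. -/
noncomputable def forwardState (x : BoundaryIndex Ω → H) (n : Fin d → ℤ) : H :=
  response (fun k => G.P k ∘L G.A) (fun j : BoundaryIndex Ω => (j.2 : Fin d → ℤ)) x n

/-- The values of `A x(n) + B u(n)` outside `Ω` that evolve backward, with zero output, from data on
the boundary. The lattice is reflected: the edge from `n - e_k` to `n` leads out of `Ω`, in the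
backward direction, to `n - e_k`. -/
noncomputable def backwardState (x : BoundaryIndex Ω → H) (n : Fin d → ℤ) : H :=
  response (fun k => G.P k ∘L ContinuousLinearMap.adjoint G.A)
    (fun j : BoundaryIndex Ω => unitIdx j.1 - (j.2 : Fin d → ℤ)) x (-n)

theorem P_boundaryValue {x : BoundaryIndex Ω → H} (hx : ∀ j, G.P j.1 (x j) = x j) (k : Fin d)
    (n : Fin d → ℤ) : G.P k (boundaryValue x k n) = boundaryValue x k n := by
  rw [boundaryValue]
  split_ifs with h
  · exact hx ⟨k, n, h⟩
  · exact map_zero _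

variable (x : BoundaryIndex Ω → H)

theorem forwardState_eq_zero (hΩ : IsShiftInvariant Ω) {n : Fin d → ℤ} (hn : n ∉ Ω) :
    G.forwardState x n = 0 :=
  response_eq_zero _ x hΩ.isUpperSet hΩ.boundaryIndex_mem hn

theorem backwardState_eq_zero (hΩ : IsShiftInvariant Ω) {n : Fin d → ℤ} (hn : n ∈ Ω) :
    G.backwardState x n = 0 :=
  response_eq_zero _ x hΩ.reflection.isUpperSet hΩ.boundaryIndex_mem_reflection
    (not_not_intro (by rwa [neg_neg]))

theorem forwardState_eq (hΩ : IsShiftInvariant Ω) (hb : HasNoInfiniteBoundary Ω)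
    (n : Fin d → ℤ) :
    G.forwardState x n = ∑ k, boundaryValue x k n +
      ∑ k, G.P k (G.A (G.forwardState x (n - unitIdx k))) :=
  response_eq _ x (finite_setOf_boundaryIndex_le hΩ hb) (hasSum_boundaryValue x fun _ => n)

theorem backwardState_eq (hΩ : IsShiftInvariant Ω) (hb : HasNoInfiniteBoundary Ω)
    (n : Fin d → ℤ) :
    G.backwardState x n = ∑ k, boundaryValue x k (n + unitIdx k) +
      ∑ k, G.P k (ContinuousLinearMap.adjoint G.A (G.backwardState x (n + unitIdx k))) := by
  have hs : HasSum (fun j : BoundaryIndex Ω =>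
      if unitIdx j.1 - (j.2 : Fin d → ℤ) = -n then x j else 0)
      (∑ k, boundaryValue x k (n + unitIdx k)) := by
    convert! hasSum_boundaryValue x fun k => n + unitIdx k using 3 with j
    rw [sub_eq_iff_eq_add, eq_neg_add_iff_add_eq, eq_comm]
  rw [backwardState, response_eq _ x (finite_setOf_reflected_boundaryIndex_le hΩ hb) hs]
  congr 1
  refine Finset.sum_congr rfl fun k _ => ?_
  rw [backwardState, neg_add']
  rfl

/-- The series `Π(z) ∑_k ∑_{n ∈ ∂_kΩ} x_k(n) z^n` consists of the output inside `Ω`, for zero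
input, and of the input outside `Ω`, for zero output. -/
theorem hasSum_obs_fst (hΩ : IsShiftInvariant Ω) (hb : HasNoInfiniteBoundary Ω)
    (p : Fin d → ℤ) :
    HasSum (fun j : BoundaryIndex Ω => (G.obs (p - j.2) (x j)).fst)
      (G.C (G.forwardState x p)) :=
  G.C.hasSum (hasSum_response _ x (finite_setOf_boundaryIndex_le hΩ hb) p)

theorem hasSum_obs_snd (hΩ : IsShiftInvariant Ω) (hb : HasNoInfiniteBoundary Ω)
    (hx : ∀ j, G.P j.1 (x j) = x j) (p : Fin d → ℤ) :
    HasSum (fun j : BoundaryIndex Ω => (G.obs (p - j.2) (x j)).snd)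
      (ContinuousLinearMap.adjoint G.B (G.backwardState x p)) := by
  convert! (ContinuousLinearMap.adjoint G.B).hasSum
    (hasSum_response _ x (finite_setOf_reflected_boundaryIndex_le hΩ hb) (-p)) using 2 with j
  conv_lhs => rw [← hx j, obs_P_snd, hx j]
  rw [bwd]
  congr 3
  abel

/-- Boundary data with vanishing output and input series are the boundary values of a null
trajectory: inside `Ω` it is the forward evolution of the data, outside `Ω` the backward one. -/
theorem exists_isNullTrajectory (hΩ : IsShiftInvariant Ω) (hb : HasNoInfiniteBoundary Ω)
    (hx : ∀ j, G.P j.1 (x j) = x j)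
    (h0 : ∀ p : Fin d → ℤ, HasSum (fun j : BoundaryIndex Ω => G.obs (p - j.2) (x j)) 0) :
    ∃ t, G.IsNullTrajectory t ∧ ∀ j : BoundaryIndex Ω, G.P j.1 (t j.2) = x j := by
  have hC : ∀ n, G.C (G.forwardState x n) = 0 := by
    intro n
    have h := (WithLp.fstL 2 ℂ Es E).hasSum (h0 n)
    rw [map_zero] at h
    exact (G.hasSum_obs_fst x hΩ hb n).unique h
  have hB : ∀ n, ContinuousLinearMap.adjoint G.B (G.backwardState x n) = 0 := by
    intro n
    have h := (WithLp.sndL 2 ℂ Es E).hasSum (h0 n)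
    rw [map_zero] at h
    exact (G.hasSum_obs_snd x hΩ hb hx n).unique h
  have hPX : ∀ n k, G.P k (G.forwardState x n) =
      boundaryValue x k n + G.P k (G.A (G.forwardState x (n - unitIdx k))) := by
    intro n k
    have h : G.forwardState x n = ∑ k, G.P k
        (boundaryValue x k n + G.A (G.forwardState x (n - unitIdx k))) := by
      simp_rw [map_add, G.P_boundaryValue hx, Finset.sum_add_distrib]
      exact G.forwardState_eq x hΩ hb n
    rw [h, map_sum, Finset.sum_eq_single k (fun j _ hj => G.P_P_apply_of_ne hj.symm _)
      (fun h => absurd (Finset.mem_univ k) h), G.P_P_apply, map_add, G.P_boundaryValue hx]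
  -- Inside `Ω` only the first summand is present, outside `Ω` only the second one.
  refine ⟨fun n => G.forwardState x n +
    ContinuousLinearMap.adjoint G.A (G.backwardState x n), fun n => ?_, fun j => ?_⟩
  · obtain ⟨h1, h2⟩ := G.U_U_symm_toLp_zero_right (G.backwardState x n)
    rw [hB, map_zero, add_zero] at h1 h2
    rw [U_toLp_zero_right, map_add, map_add, h1, h2, hC, add_zero]
    congr 2
    have hX : ∀ k, G.P k (G.forwardState x (n + unitIdx k)) =
        boundaryValue x k (n + unitIdx k) + G.P k (G.A (G.forwardState x n)) := fun k => by
      rw [hPX, add_sub_cancel_right]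
    simp_rw [map_add, hX]
    rw [Finset.sum_add_distrib, Finset.sum_add_distrib, G.sum_P_apply,
      G.backwardState_eq x hΩ hb n]
    abel
  · rw [map_add, hPX, G.forwardState_eq_zero x hΩ (hΩ.mem_finBoundary_iff.1 j.2.2).2,
      G.backwardState_eq_zero x hΩ (hΩ.boundaryIndex_mem j)]
    have : boundaryValue x j.1 j.2 = x j := by
      rw [boundaryValue, dif_pos j.2.2]
    simp [this]

variable {G} {t : (Fin d → ℤ) → H}

theorem IsNullTrajectory.A_apply (ht : G.IsNullTrajectory t) (n : Fin d → ℤ) :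
    G.A (t n) = ∑ k, G.P k (t (n + unitIdx k)) := by
  have := ht n
  rw [U_toLp_zero_right] at this
  exact congrArg WithLp.fst this

theorem IsNullTrajectory.C_apply (ht : G.IsNullTrajectory t) (n : Fin d → ℤ) :
    G.C (t n) = 0 := by
  have := ht n
  rw [U_toLp_zero_right] at this
  exact congrArg WithLp.snd this

theorem IsNullTrajectory.P_A_apply (ht : G.IsNullTrajectory t) (n : Fin d → ℤ) (k : Fin d) :
    G.P k (G.A (t n)) = G.P k (t (n + unitIdx k)) := by
  rw [ht.A_apply, map_sum, Finset.sum_eq_single k (fun j _ hj => G.P_P_apply_of_ne hj.symm _)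
      (fun h => absurd (Finset.mem_univ k) h), G.P_P_apply]

theorem IsNullTrajectory.adjoint_A_A_apply (ht : G.IsNullTrajectory t) (n : Fin d → ℤ) :
    ContinuousLinearMap.adjoint G.A (G.A (t n)) = t n := by
  have := (G.U_symm_U_toLp_zero_right (t n)).1
  rwa [ht.C_apply, map_zero, add_zero] at this

theorem IsNullTrajectory.adjoint_B_A_apply (ht : G.IsNullTrajectory t) (n : Fin d → ℤ) :
    ContinuousLinearMap.adjoint G.B (G.A (t n)) = 0 := by
  have := (G.U_symm_U_toLp_zero_right (t n)).2
  rwa [ht.C_apply, map_zero, add_zero] at this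

theorem boundaryValue_of_mem {k : Fin d} {n : Fin d → ℤ} (h : n ∈ finBoundary Ω k) :
    boundaryValue (fun j : BoundaryIndex Ω => G.P j.1 (t j.2)) k n = G.P k (t n) :=
  dif_pos h

theorem boundaryValue_of_notMem {k : Fin d} {n : Fin d → ℤ} (h : n ∉ finBoundary Ω k) :
    boundaryValue (fun j : BoundaryIndex Ω => G.P j.1 (t j.2)) k n = 0 :=
  dif_neg h

/-- Inside `Ω`, a null trajectory is the forward evolution of its boundary values. -/
theorem IsNullTrajectory.forwardState_eq (ht : G.IsNullTrajectory t) (hΩ : IsShiftInvariant Ω)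
    (hb : HasNoInfiniteBoundary Ω) (n : Fin d → ℤ) :
    G.forwardState (fun j : BoundaryIndex Ω => G.P j.1 (t j.2)) n = Ω.indicator t n := by
  rw [← sub_eq_zero]
  refine eq_zero_of_predecessors (hΩ.hasBoundedPast hb) (D := fun n => G.forwardState
    (fun j : BoundaryIndex Ω => G.P j.1 (t j.2)) n - Ω.indicator t n) (fun n hn => ?_)
    (fun n hn => ?_) n
  · rw [G.forwardState_eq_zero _ hΩ hn, Set.indicator_of_notMem hn, sub_zero]
  · rw [G.forwardState_eq _ hΩ hb, sub_eq_zero]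
    simp_rw [fun k => sub_eq_zero.1 (hn k)]
    rw [← Finset.sum_add_distrib]
    by_cases hnΩ : n ∈ Ω
    · rw [Set.indicator_of_mem hnΩ]
      conv_rhs => rw [← G.sum_P_apply (t n)]
      refine Finset.sum_congr rfl fun k _ => ?_
      by_cases hk : n - unitIdx k ∈ Ω
      · rw [boundaryValue_of_notMem fun h => (hΩ.mem_finBoundary_iff.1 h).2 hk,
          Set.indicator_of_mem hk, ht.P_A_apply, sub_add_cancel, zero_add]
      · rw [boundaryValue_of_mem (hΩ.mem_finBoundary_iff.2 ⟨hnΩ, hk⟩),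
          Set.indicator_of_notMem hk, map_zero, map_zero, add_zero]
    · rw [Set.indicator_of_notMem hnΩ]
      refine Finset.sum_eq_zero fun k _ => ?_
      rw [boundaryValue_of_notMem fun h => hnΩ (hΩ.mem_finBoundary_iff.1 h).1,
        Set.indicator_of_notMem fun h => hnΩ (hΩ.isUpperSet (sub_unitIdx_le n k) h), map_zero,
        map_zero, add_zero]

/-- Outside `Ω`, a null trajectory is the backward evolution of its boundary values. -/
theorem IsNullTrajectory.backwardState_eq (ht : G.IsNullTrajectory t) (hΩ : IsShiftInvariant Ω)
    (hb : HasNoInfiniteBoundary Ω) (n : Fin d → ℤ) :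
    G.backwardState (fun j : BoundaryIndex Ω => G.P j.1 (t j.2)) n =
      Ωᶜ.indicator (fun n => G.A (t n)) n := by
  rw [← sub_eq_zero, ← neg_neg n]
  refine eq_zero_of_predecessors (hΩ.reflection.hasBoundedPast hb.reflection)
    (D := fun n => G.backwardState (fun j : BoundaryIndex Ω => G.P j.1 (t j.2)) (-n) -
      Ωᶜ.indicator (fun n => G.A (t n)) (-n)) (fun n hn => ?_) (fun n hn => ?_) (-n)
  · have hn' : -n ∈ Ω := not_not.1 hn
    rw [G.backwardState_eq_zero _ hΩ hn', Set.indicator_of_notMem (not_not_intro hn'), sub_zero]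
  · have hn' : ∀ k, G.backwardState (fun j : BoundaryIndex Ω => G.P j.1 (t j.2))
        (-n + unitIdx k) = Ωᶜ.indicator (fun n => G.A (t n)) (-n + unitIdx k) := by
      intro k
      have := sub_eq_zero.1 (hn k)
      rwa [neg_sub', sub_neg_eq_add] at this
    generalize -n = n at hn' ⊢
    rw [G.backwardState_eq _ hΩ hb, sub_eq_zero]
    simp_rw [hn']
    rw [← Finset.sum_add_distrib]
    by_cases hnΩ : n ∈ Ω
    · rw [Set.indicator_of_notMem (not_not_intro hnΩ)]
      refine Finset.sum_eq_zero fun k _ => ?_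
      rw [boundaryValue_of_notMem fun h => (hΩ.mem_finBoundary_iff.1 h).2 (by simpa using hnΩ),
        Set.indicator_of_notMem (not_not_intro (hΩ n hnΩ k)), map_zero, map_zero, add_zero]
    · rw [Set.indicator_of_mem (Set.mem_compl hnΩ)]
      conv_rhs => rw [ht.A_apply]
      refine Finset.sum_congr rfl fun k _ => ?_
      by_cases hk : n + unitIdx k ∈ Ω
      · rw [boundaryValue_of_mem (hΩ.mem_finBoundary_iff.2 ⟨hk, by simpa using hnΩ⟩),
          Set.indicator_of_notMem (not_not_intro hk), map_zero, map_zero, add_zero]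
      · rw [boundaryValue_of_notMem fun h => hk (hΩ.mem_finBoundary_iff.1 h).1,
          Set.indicator_of_mem (Set.mem_compl hk), ht.adjoint_A_A_apply, zero_add]

/-- A null trajectory is determined by its boundary values. -/
theorem IsNullTrajectory.eq_zero (ht : G.IsNullTrajectory t) (hΩ : IsShiftInvariant Ω)
    (hb : HasNoInfiniteBoundary Ω) (h0 : ∀ j : BoundaryIndex Ω, G.P j.1 (t j.2) = 0)
    (n : Fin d → ℤ) : t n = 0 := by
  by_cases hn : n ∈ Ω
  · have := ht.forwardState_eq hΩ hb n
    rw [Set.indicator_of_mem hn] at this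
    rw [← this]
    simp [h0, forwardState, response]
  · have := ht.backwardState_eq hΩ hb n
    rw [Set.indicator_of_mem (Set.mem_compl hn)] at this
    rw [← ht.adjoint_A_A_apply, ← this]
    simp [h0, backwardState, response]

/-- The boundary values of a null trajectory have vanishing output and input series. -/
theorem IsNullTrajectory.hasSum_inner_obs (ht : G.IsNullTrajectory t) (hΩ : IsShiftInvariant Ω)
    (hb : HasNoInfiniteBoundary Ω) (p : Fin d → ℤ) (v : WithLp 2 (Es × E)) :
    HasSum (fun j : BoundaryIndex Ω => ⟪v, G.obs (p - j.2) (G.P j.1 (t j.2))⟫_ℂ) 0 := by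
  have h1 := G.hasSum_obs_fst (fun j : BoundaryIndex Ω => G.P j.1 (t j.2)) hΩ hb p
  have h2 := G.hasSum_obs_snd (fun j : BoundaryIndex Ω => G.P j.1 (t j.2)) hΩ hb
    (fun j => G.P_P_apply _ _) p
  rw [ht.forwardState_eq hΩ hb] at h1
  rw [ht.backwardState_eq hΩ hb] at h2
  classical
  have h1' : G.C (Ω.indicator t p) = 0 := by
    rw [Set.indicator_apply]
    split_ifs
    · exact ht.C_apply p
    · exact map_zero _
  have h2' : ContinuousLinearMap.adjoint G.B (Ωᶜ.indicator (fun n => G.A (t n)) p) = 0 := by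
    rw [Set.indicator_apply]
    split_ifs
    · exact ht.adjoint_B_A_apply p
    · exact map_zero _
  rw [h1'] at h1
  rw [h2'] at h2
  have h := ((innerSL ℂ v.fst).hasSum h1).add ((innerSL ℂ v.snd).hasSum h2)
  simpa [WithLp.prod_inner_apply] using h

/-- The energy of a null trajectory is conserved: `‖P_k x(n)‖²` is a divergence-free flow. -/
theorem IsNullTrajectory.sum_norm_sq_eq (ht : G.IsNullTrajectory t)
    {K : Fin d → PosKernel d (WithLp 2 (Es × E))} (hF : IsFactorization K G.P G.obs)
    (n : Fin d → ℤ) :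
    ∑ k, ‖G.P k (t n)‖ ^ 2 = ∑ k, ‖G.P k (t (n + unitIdx k))‖ ^ 2 := by
  rw [← hF.norm_sq_sum_proj, ← hF.norm_sq_sum_proj fun k => t (n + unitIdx k), G.sum_P_apply]
  have h := G.U.norm_map (WithLp.toLp 2 (t n, 0))
  rw [ht n] at h
  have h' := congrArg (· ^ 2) h
  simp only [WithLp.prod_norm_sq_eq_of_L2] at h'
  simpa using h'.symm

/-- Minimality on one set `Ω₀` implies scattering minimality on every set `Ω`: data on the boundary
of `Ω` with vanishing series extend to a null trajectory, whose boundary values on `Ω₀` have finite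
energy and lie in the overlap of the spaces `z^n H(K_k)`. -/
theorem scatteringMinimal_of_isMinimalDecomposition
    {K : Fin d → PosKernel d (WithLp 2 (Es × E))} (hc : G.Compatible K)
    (hs : G.StrictlyCloselyConnected) {Ω₀ : Set (Fin d → ℤ)} (hΩ₀ : IsShiftInvariant Ω₀)
    (hb₀ : HasNoInfiniteBoundary Ω₀) (hmin : IsMinimalDecomposition Ω₀ K) :
    G.ScatteringMinimal := by
  intro Ω hΩ hb x hx h0
  rw [strictlyCloselyConnected_iff] at hs
  have hF := G.isFactorization hc
  obtain ⟨t, ht, htx⟩ := G.exists_isNullTrajectory (fun j => x j) hΩ hb hx h0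
  have hsum : Summable fun j : BoundaryIndex Ω => ‖G.P j.1 (t j.2)‖ ^ 2 := by
    have := (lp.memℓp x).summable (by norm_num)
    simpa [htx] using this
  have hsum₀ : Summable fun j : BoundaryIndex Ω₀ => ‖G.P j.1 (t j.2)‖ ^ 2 :=
    summable_boundaryIndex_of_summable hΩ₀ hb₀ hΩ hb (a := fun p => ‖G.P p.1 (t p.2)‖ ^ 2)
      (fun p => by positivity) (ht.sum_norm_sq_eq hF) hsum
  have hzero : ∀ j : BoundaryIndex Ω₀, G.P j.1 (t j.2) = 0 := by
    intro j
    refine hs _ fun n => ?_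
    have := apply_eq_zero_of_overlappingSpace_eq_bot _ hmin.2
      (fun j n => G.obs (n - j.2) ∘L G.P j.1) (fun j => hF.shift_coeff_eq j.1 j.2)
      (fun j => G.P j.1 (t j.2)) (memℓp_gen (by simpa using hsum₀)) (fun n v => ?_) j (n + j.2)
    · simpa [G.P_P_apply] using this
    · simp only [ContinuousLinearMap.comp_apply, G.P_P_apply]
      exact ht.hasSum_inner_obs hΩ₀ hb₀ n v
  ext j
  rw [← htx j, ht.eq_zero hΩ₀ hb₀ hzero, map_zero]
  rfl

end GRColligation

theorem corollary7p2 {d : ℕ} {E : Type u} {Es : Type v}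
    [NormedAddCommGroup E] [InnerProductSpace ℂ E] [CompleteSpace E]
    [NormedAddCommGroup Es] [InnerProductSpace ℂ Es] [CompleteSpace Es]
    (S : (Fin d → ℤ) → (E →L[ℂ] Es))
    (K : Fin d → PosKernel d (WithLp 2 (Es × E)))
    (hK : IsAugmentedAglerDecomposition S K)
    (hscc : IsStrictlyCloselyConnectedDecomposition K) :
    -- existence
    (∃ (H : Type (max u v)) (_ : NormedAddCommGroup H) (_ : InnerProductSpace ℂ H)
        (_ : CompleteSpace H) (G : GRColligation d H E Es),
      G.Realizes S ∧ G.Compatible K ∧ G.CloselyConnected) ∧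
    -- uniqueness up to unitary equivalence
    (∀ (H : Type w) (H' : Type w') [NormedAddCommGroup H] [InnerProductSpace ℂ H]
        [CompleteSpace H] [NormedAddCommGroup H'] [InnerProductSpace ℂ H'] [CompleteSpace H']
        (G : GRColligation d H E Es) (G' : GRColligation d H' E Es),
      G.Realizes S → G.Compatible K → G.CloselyConnected →
      G'.Realizes S → G'.Compatible K → G'.CloselyConnected →
      G.UnitarilyEquivalent G') ∧
    -- strict close connectedness, and scattering-minimality for minimal decompositions
    (∀ (H : Type w) [NormedAddCommGroup H] [InnerProductSpace ℂ H] [CompleteSpace H]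
        (G : GRColligation d H E Es),
      G.Realizes S → G.Compatible K → G.CloselyConnected →
      G.StrictlyCloselyConnected ∧
      ∀ Ω : Set (Fin d → ℤ), IsShiftInvariant Ω → HasNoInfiniteBoundary Ω →
        IsMinimalDecomposition Ω K → G.ScatteringMinimal) := by
  refine ⟨?_, ?_, ?_⟩
  · have hF := isFactorization_canonical K
    have hinj := eq_zero_of_canonicalEval K hscc.1
    obtain ⟨U, hU⟩ := exists_unitary_outputSide_eq_inputSide hK hF hinj hscc.2
    let G : GRColligation d (canonicalSpace K) E Es :=
      ⟨U, canonicalProj K, hF.isStarProjection, hF.orthogonal, hF.sum_eq_one⟩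
    have hobs : ∀ n, G.obs n = canonicalEval K n := G.obs_eq_of_outputSide_U hK hF hU
    refine ⟨canonicalSpace K, inferInstance, inferInstance, inferInstance, G,
      G.realizes_of_outputSide_U hK hF hU, fun k n m => ?_, ?_⟩
    · rw [hobs, hobs]
      exact hF.coeff_eq k n m
    · refine GRColligation.StrictlyCloselyConnected.closelyConnected
        (GRColligation.strictlyCloselyConnected_iff.2 fun h hh => hinj h fun n => ?_)
      rw [← hobs, hh]
  · intro H H' _ _ _ _ _ _ G G' hr hc hcc hr' hc' hcc'
    exact GRColligation.unitarilyEquivalent hK hscc.2 hr hc (hcc.strictlyCloselyConnected hc hscc)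
      hr' hc' (hcc'.strictlyCloselyConnected hc' hscc)
  · intro H _ _ _ G hr hc hcc
    have hs := hcc.strictlyCloselyConnected hc hscc
    exact ⟨hs, fun Ω hΩ hb hmin =>
      GRColligation.scatteringMinimal_of_isMinimalDecomposition hc hs hΩ hb hmin⟩
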